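/- Let $p$ be a prime and let $(G,\dot+)$ be a locally compact abelian group whose topology is generated by a chain of open subgroups $\cdots\supset G_{-1}\supset G_0\supset G_1\supset\cdots$ with $\bigcup_{n\in\mathbb Z} G_n=G$, $\bigcap_{n\in\mathbb Z} G_n=\{0\}$ and $|G_n/G_{n+1}|=p$ for all $n\in\mathbb Z$. Fix $g_n\in G_n\setminus G_{n+1}$ $(n\in\mathbb Z)$ and assume that there are fixed digits $c_1,\dots,c_\tau\in\{0,\dots,p-1\}$ with $pg_n=c_1g_{n+1}\dot+\cdots\dot+c_\tau g_{n+\tau}$ for all $n$. Every $x\in G$ is uniquely $x=\sum_{n\in\mathbb Z}a_ng_n$ with $a_n\in\{0,\dots,p-1\}$ and only finitely many non-zero $a_n$ with $n<0$; put $\mathcal Ax=\sum_n a_ng_{n-1}$, an automorphism of $G$. Let $H_0$ be the set of all finite sums $a_{-1}g_{-1}\dot+\cdots\dot+a_{-k}g_{-k}$ with digits $a_i\in\{0,\dots,p-1\}$. Let $X$ be the character group of $G$, $G_n^\bot\subset X$ the annihilator of $G_n$, and define $\chi\mathcal A^n$ by $(\chi\mathcal A^n,x)=(\chi,\mathcal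 A^nx)$. Fix $r_n\in G_{n+1}^\bot\setminus G_n^\bot$ $(n\in\mathbb Z)$. Let $\mu,\nu$ be the Haar measures on $G$ and $X$ with $\mu(G_0)=\nu(G_0^\bot)=1$, and for $f\in L_2(G)$ let $\hat f(\chi)=\lim_{n\to\infty}\int_{G_{-n}}f(x)\overline{(\chi,x)}\,d\mu(x)$, the limit being taken in $L_2(X)$. Let $M,N\ge 0$ be integers and let $\varphi:G\to\mathbb C$ be supported in $G_{-N}$ and constant on the cosets of $G_M$. Let $0\le s\le N$ and $u$ be integers, let $\gamma_k\in\{0,\dots,p-1\}$, and put $$E=G_{-s}^\bot r_{-s}^{\gamma_{-s}}r_{-s+1}^{\gamma_{-s+1}}\cdots r_u^{\gamma_u}.$$ Let $m:X\to\mathbb C$ be a function (a mask) such that $\hat\varphi(\chi\mathcal A^{-1})m(\chi)=1$ for $\chi\in E$ and $m(\chi)=0$ for $\chi\notin E$, and let $\psi\in L_2(G)$ be the function with $\hat\psi(\chi)=\hat\varphi(\chi\mathcal A^{-1})m(\chi)$. Write $\psi_{n,h}(x)=p^{n/2}\psi(\mathcal A^nx\dot-h)$. Then for every $f\in L_2(G)$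 and every $n\in\mathbb Z$ $$\sum_{h\in H_0}|\langle\psi_{n,h},f\rangle|^2=\int_{E\mathcal A^n}|\hat f(\chi)|^2\,d\nu(\chi).$$ If, moreover, the characters $r_k$ are chosen so that $r_k\mathcal A=r_{k+1}$ for all $k\in\mathbb Z$, then also $$\sum_{h\in H_0}|\langle\psi_{n,h},f\rangle|^2=\int_{G_{n-s}^\bot r_{n-s}^{\gamma_{-s}}r_{n-s+1}^{\gamma_{-s+1}}\cdots r_{n+u}^{\gamma_u}}|\hat f(\chi)|^2\,d\nu(\chi).$$ -/

import Mathlib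

open MeasureTheory Filter Topology ComplexConjugate

noncomputable section

namespace ZeroDim

variable {G : Type*} [AddCommGroup G] [TopologicalSpace G]

/-- A basic chain `⋯ ⊃ G_{-1} ⊃ G_0 ⊃ G_1 ⊃ ⋯` of subgroups of `G`, with union `G`, intersection
`{0}`, all quotients `G_n / G_{n+1}` of order `p`, and generating the topology of `G`. -/
structure IsBasicChain (p : ℕ) (Gs : ℤ → AddSubgroup G) : Prop where
  succ_le : ∀ n, Gs (n + 1) ≤ Gs n
  exists_mem : ∀ x : G, ∃ n, x ∈ Gs n
  eq_zero : ∀ x : G, (∀ n, x ∈ Gs n) → x = 0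
  relIndex_eq : ∀ n, (Gs (n + 1)).relIndex (Gs n) = p
  nhds_basis : (𝓝 (0 : G)).HasBasis (fun _ : ℤ => True) (fun n => (Gs n : Set G))

/-- A basic system: `g_n ∈ G_n \ G_{n+1}`. -/
def IsBasicSystem (Gs : ℤ → AddSubgroup G) (g : ℤ → G) : Prop :=
  ∀ n, g n ∈ Gs n ∧ g n ∉ Gs (n + 1)

/-- There are fixed digits `c_1, …, c_τ` with `p g_n = c_1 g_{n+1} + ⋯ + c_τ g_{n+τ}` for all `n`. -/
def HasUniformCarry (p : ℕ) (g : ℤ → G) : Prop :=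
  ∃ (τ : ℕ) (c : ℕ → Fin p), ∀ n : ℤ,
    p • g n = ∑ k ∈ Finset.Icc 1 τ, (c k : ℕ) • g (n + k)

/-- `x = ∑ a_n g_n` with digits `0 ≤ a_n < p`, finitely many of negative index being non-zero. -/
def IsExpansion (p : ℕ) (g : ℤ → G) (a : ℤ → ℕ) (x : G) : Prop :=
  (∀ n, a n < p) ∧ (∃ m : ℤ, ∀ n < m, a n = 0) ∧ HasSum (fun n => a n • g n) x

open Classical in
/-- The digits of `x` in the basic system `g`. -/
def digit (p : ℕ) (g : ℤ → G) (x : G) : ℤ → ℕ :=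
  if h : ∃ a, IsExpansion p g a x then h.choose else 0

/-- The map `𝒜 : ∑ a_n g_n ↦ ∑ a_n g_{n-1}`. -/
def dilation (p : ℕ) (g : ℤ → G) (x : G) : G :=
  ∑' n : ℤ, digit p g x n • g (n - 1)

/-- The integer powers `𝒜^n` of the bijection `𝒜`. -/
def dilationPow (p : ℕ) (g : ℤ → G) : ℤ → G → G
  | Int.ofNat k => (dilation p g)^[k]
  | Int.negSucc k => (Function.invFun (dilation p g))^[k + 1]

/-- `H_0`: the finite sums `a_1 g_{-1} + ⋯ + a_s g_{-s}` with digits `0 ≤ a_k < p`. -/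
def H0 (p : ℕ) (g : ℤ → G) : Set G :=
  {h | ∃ (s : ℕ) (a : ℕ → Fin p), h = ∑ k ∈ Finset.Icc 1 s, (a k : ℕ) • g (-(k : ℤ))}

/-- The group `X` of continuous unitary characters of `G`, written multiplicatively. -/
abbrev Chars (G : Type*) [AddCommGroup G] [TopologicalSpace G] : Type _ :=
  PontryaginDual (Multiplicative G)

/-- The value `(χ, x)` as a complex number. -/
def pair (χ : Chars G) (x : G) : ℂ := (χ (Multiplicative.ofAdd x) : ℂ)

/-- The annihilator `G_n^⊥`. -/
def annihilator (Gs : ℤ → AddSubgroup G) (n : ℤ) : Set (Chars G) :=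
  {χ | ∀ x ∈ Gs n, pair χ x = 1}

/-- A Rademacher system: `r_n ∈ G_{n+1}^⊥ \ G_n^⊥`. -/
def IsRademacher (Gs : ℤ → AddSubgroup G) (r : ℤ → Chars G) : Prop :=
  ∀ n, r n ∈ annihilator Gs (n + 1) ∧ r n ∉ annihilator Gs n

/-- The coset `G_l^⊥ r_l^{γ_l} r_{l+1}^{γ_{l+1}} ⋯ r_u^{γ_u}`. -/
def dualCoset {p : ℕ} (Gs : ℤ → AddSubgroup G) (r : ℤ → Chars G) (γ : ℤ → Fin p) (l u : ℤ) :
    Set (Chars G) :=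
  {χ | ∃ η ∈ annihilator Gs l, χ = η * ∏ k ∈ Finset.Icc l u, r k ^ (γ k : ℕ)}

open Classical in
/-- The character `χ 𝒜^n`, given by `(χ 𝒜^n, x) = (χ, 𝒜^n x)`. -/
def charDil (p : ℕ) (g : ℤ → G) (n : ℤ) (χ : Chars G) : Chars G :=
  if h : ∃ η : Chars G, ∀ x, pair η x = pair χ (dilationPow p g n x) then h.choose else 1

/-- The class `𝔇_M(G_{-N})` of step functions: supported in `G_{-N}`, constant on cosets of `G_M`
(on a group with a basic chain such functions lie in every `L_q`). -/
def IsStepFunction (Gs : ℤ → AddSubgroup G) (M N : ℕ) (φ : G → ℂ) : Prop :=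
  Function.support φ ⊆ Gs (-(N : ℤ)) ∧ ∀ x, ∀ y ∈ Gs (M : ℤ), φ (x + y) = φ x

variable [MeasurableSpace G]

/-- The Fourier integral `∫ f(x) \overline{(χ, x)} dμ(x)` of an integrable function. -/
def fourierInt (μ : Measure G) (f : G → ℂ) (χ : Chars G) : ℂ :=
  ∫ x, f x * conj (pair χ x) ∂μ

variable [MeasurableSpace (Chars G)]

/-- `F` is the Fourier transform of `f ∈ L_2(G)`: the limit in `L_2(X)` of the Fourier integrals of
`f` over `G_{-n}`, as `n → ∞`. -/
def IsFourierL2 (Gs : ℤ → AddSubgroup G) (μ : Measure G) (ν : Measure (Chars G))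
    (f : G → ℂ) (F : Chars G → ℂ) : Prop :=
  MemLp F 2 ν ∧
    Tendsto (fun n : ℕ =>
      eLpNorm (fun χ => F χ - fourierInt (μ.restrict (Gs (-(n : ℤ)) : Set G)) f χ) 2 ν)
      atTop (𝓝 0)

open Classical in
/-- The Fourier transform on `L_2(G)` (determined up to `ν`-null sets). -/
def fourierL2 (Gs : ℤ → AddSubgroup G) (μ : Measure G) (ν : Measure (Chars G))
    (f : G → ℂ) : Chars G → ℂ :=
  if h : ∃ F, IsFourierL2 Gs μ ν f F then h.choose else 0

/-- `ψ_{n,h}(x) = p^{n/2} ψ(𝒜^n x - h)`. -/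
def waveletShift (p : ℕ) (g : ℤ → G) (ψ : G → ℂ) (n : ℤ) (h : G) (x : G) : ℂ :=
  (((p : ℝ) ^ ((n : ℝ) / 2) : ℝ) : ℂ) * ψ (dilationPow p g n x - h)

/-- The wavelet coefficient `c_{n,h}(f) = ∫ f \overline{ψ_{n,h}} dμ`. -/
def waveletCoeff (p : ℕ) (g : ℤ → G) (μ : Measure G) (ψ : G → ℂ) (n : ℤ) (h : G)
    (f : G → ℂ) : ℂ :=
  ∫ x, f x * conj (waveletShift p g ψ n h x) ∂μ

end ZeroDim

end

/-!
Since `ψ̂` is the indicator function of the coset `E = ρ G_{-s}^⊥`, the function `ψ` is explicitly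
`p^{-s} 1_{G_{-s}} ρ`, and `ψ_{n,h}` is supported on a coset of `G_{n-s}`, where it is a multiple of
the character `ρ𝒜^n`. As `h` runs over `H_0`, the points `𝒜^{-n} h` represent the cosets of `G_n`,
so every coset of `G_{n-s}` occurs `p^s` times. The sum of the squared coefficients therefore runs
over the integrals of `f` against `ρ𝒜^n` on the cosets of `G_{n-s}`; these are the Fourier
coefficients of `f̂` on `(ρ𝒜^n) G_{n-s}^⊥ = E𝒜^n`, and the identity is Parseval's.

The digitwise map `𝒜` is additive because its graph is the closure of a subgroup, that of the
pairs `(∑ c_n g_n, ∑ c_n g_{n-1})` with integer coefficients: by the uniform carry the first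
entry of such a pair lies in `G_k` exactly when the second lies in `G_{k-1}`.
-/

noncomputable section

namespace ZeroDim

section FiniteSums

variable {G : Type*} [AddCommGroup G] {p : ℕ} {g : ℤ → G}

theorem sum_Icc_neg (s : ℕ) (F : ℤ → G) :
    ∑ k ∈ Finset.Icc 1 s, F (-(k : ℤ)) = ∑ n ∈ Finset.Ico (-(s : ℤ)) 0, F n :=
  Finset.sum_nbij' (fun k => -(k : ℤ)) (fun n => (-n).toNat) (by simp; lia) (by simp; lia)
    (by simp) (by simp; lia) (by simp)

theorem sum_mem_H0 {a : ℤ → ℕ} (ha : ∀ n, a n < p) (m : ℤ) :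
    ∑ n ∈ Finset.Ico m 0, a n • g n ∈ H0 p g := by
  refine ⟨(-m).toNat, fun k => ⟨a (-k), ha _⟩, ?_⟩
  rw [sum_Icc_neg _ fun n => a n • g n]
  congr 1
  ext n
  simp only [Finset.mem_Ico]
  lia

theorem exists_digits_of_mem_H0 {x : G} (hx : x ∈ H0 p g) :
    ∃ a : ℤ → ℕ, (∀ n, a n < p) ∧ ∀ᶠ m in atBot, x = ∑ n ∈ Finset.Ico m 0, a n • g n := by
  obtain ⟨s, a, rfl⟩ := hx
  let b : ℤ → ℕ := fun n => if n < -(s : ℤ) then 0 else a (-n).toNat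
  refine ⟨b, fun n => ?_, (eventually_le_atBot (-(s : ℤ))).mono fun m hm => ?_⟩
  · by_cases hn : n < -(s : ℤ)
    · simpa [b, hn] using (Nat.zero_le _).trans_lt (a 0).isLt
    · simp [b, hn]
  · calc ∑ k ∈ Finset.Icc 1 s, (a k : ℕ) • g (-(k : ℤ))
        = ∑ k ∈ Finset.Icc 1 s, b (-(k : ℤ)) • g (-(k : ℤ)) :=
          Finset.sum_congr rfl fun k hk => by simp [b, (Finset.mem_Icc.1 hk).2]
      _ = ∑ n ∈ Finset.Ico (-(s : ℤ)) 0, b n • g n := sum_Icc_neg s fun n => b n • g n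
      _ = ∑ n ∈ Finset.Ico m 0, b n • g n := by
        refine Finset.sum_subset (Finset.Ico_subset_Ico_left hm) fun n hn hns => ?_
        simp only [Finset.mem_Ico] at hn hns
        simp [b, show n < -(s : ℤ) by lia]

end FiniteSums

section Digits

variable {G : Type*} [AddCommGroup G] [TopologicalSpace G] {p : ℕ} {Gs : ℤ → AddSubgroup G}
  {g : ℤ → G}

theorem IsBasicChain.antitone (h : IsBasicChain p Gs) : Antitone Gs :=
  antitone_int_of_succ_le h.succ_le

theorem IsBasicChain.relIndex_add (h : IsBasicChain p Gs) (m : ℤ) (k : ℕ) :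
    (Gs (m + k)).relIndex (Gs m) = p ^ k := by
  induction k with
  | zero => simp
  | succ k ih =>
    rw [Nat.cast_succ, ← add_assoc, ← AddSubgroup.relIndex_mul_relIndex _ _ _ (h.succ_le _)
      (h.antitone (by lia : m ≤ m + k)), ih, h.relIndex_eq, pow_succ']

theorem IsBasicChain.nsmul_mem (h : IsBasicChain p Gs) {n : ℤ} {x : G} (hx : x ∈ Gs n) :
    p • x ∈ Gs (n + 1) := by
  simpa only [h.relIndex_eq] using (Gs (n + 1)).nsmul_relIndex_mem hx

theorem IsBasicSystem.mem (hg : IsBasicSystem Gs g) (h : IsBasicChain p Gs) {m n : ℤ}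
    (hmn : m ≤ n) : g n ∈ Gs m :=
  h.antitone hmn (hg n).1

theorem IsBasicSystem.dvd_of_zsmul_mem [Fact p.Prime] (hg : IsBasicSystem Gs g)
    (h : IsBasicChain p Gs) {n z : ℤ} (hz : z • g n ∈ Gs (n + 1)) : (p : ℤ) ∣ z := by
  by_contra hdvd
  obtain ⟨a, b, hab⟩ : IsCoprime (p : ℤ) z :=
    (Nat.prime_iff_prime_int.1 Fact.out).irreducible.coprime_iff_not_dvd.2 hdvd
  have hgn : g n = a • (p • g n) + b • (z • g n) := by
    rw [← natCast_zsmul, smul_smul, smul_smul, ← add_smul, hab, one_smul]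
  exact (hg n).2 (hgn ▸ add_mem (zsmul_mem (h.nsmul_mem (hg n).1) _) (zsmul_mem hz _))

theorem IsBasicSystem.exists_digit [Fact p.Prime] (hg : IsBasicSystem Gs g)
    (h : IsBasicChain p Gs) {n : ℤ} {x : G} (hx : x ∈ Gs n) :
    ∃ a < p, x - a • g n ∈ Gs (n + 1) := by
  have hcard : Nat.card (Gs n ⧸ (Gs (n + 1)).addSubgroupOf (Gs n)) = p := h.relIndex_eq n
  have hne : ((⟨g n, (hg n).1⟩ : Gs n) : Gs n ⧸ (Gs (n + 1)).addSubgroupOf (Gs n)) ≠ 0 :=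
    mt (QuotientAddGroup.eq_zero_iff _).1 (hg n).2
  obtain ⟨k, hk⟩ := (AddSubmonoid.mem_multiples_iff _ _).1
    (mem_multiples_of_prime_card hcard (g' := ((⟨x, hx⟩ : Gs n) : _ ⧸ _)) hne)
  have hxk : -(k • g n) + x ∈ Gs (n + 1) := by
    rwa [← QuotientAddGroup.mk_nsmul, QuotientAddGroup.eq] at hk
  refine ⟨k % p, Nat.mod_lt _ (Fact.out : p.Prime).pos, ?_⟩
  have hsplit : x - (k % p) • g n = (-(k • g n) + x) + (k / p) • (p • g n) := by
    conv_rhs => rw [← Nat.mod_add_div' k p, add_smul, mul_smul]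
    simp [Nat.add_mul_div_right, (Fact.out : p.Prime).pos, Nat.div_eq_of_lt, Nat.mod_lt]
    abel
  exact hsplit ▸ add_mem hxk (nsmul_mem (h.nsmul_mem (hg n).1) _)

theorem IsBasicSystem.exists_digits [Fact p.Prime] (hg : IsBasicSystem Gs g)
    (h : IsBasicChain p Gs) {m : ℤ} {x : G} (hx : x ∈ Gs m) :
    ∃ a : ℤ → ℕ, (∀ n, a n < p) ∧ (∀ n < m, a n = 0) ∧
      ∀ k ≥ m, x - ∑ n ∈ Finset.Ico m k, a n • g n ∈ Gs k := by
  choose! d hdp hd using fun (n : ℤ) (y : G) (hy : y ∈ Gs n) => hg.exists_digit h hy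
  let rem : ℕ → G := Nat.rec x fun k y => y - d (m + k) y • g (m + k)
  have hrem : ∀ k : ℕ, rem k ∈ Gs (m + k) := fun k => by
    induction k with
    | zero => simpa [rem] using hx
    | succ k ih => simpa only [Nat.cast_succ, add_assoc] using hd _ _ ih
  let a : ℤ → ℕ := fun n => if n < m then 0 else d n (rem (n - m).toNat)
  have hsum : ∀ k : ℕ, x - ∑ n ∈ Finset.Ico m (m + k), a n • g n = rem k := fun k => by
    induction k with
    | zero => simp [rem]
    | succ k ih =>
      rw [Nat.cast_succ, ← add_assoc, ← Finset.sum_Ico_add_eq_sum_Ico_add_one (by lia),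
        ← sub_sub, ih]
      simp [a, rem]
  refine ⟨a, fun n => ?_, fun n hn => if_pos hn, fun k hk => ?_⟩
  · obtain hn | ⟨k, rfl⟩ : n < m ∨ ∃ k : ℕ, n = m + k :=
      (lt_or_ge n m).imp_right Int.exists_add_of_le
    · simpa [a, hn] using (Fact.out : p.Prime).pos
    · simpa [a, show ¬ m + (k : ℤ) < m by lia] using hdp _ _ (hrem k)
  · obtain ⟨k, rfl⟩ := Int.exists_add_of_le hk
    exact hsum k ▸ hrem k

theorem IsBasicSystem.dvd_of_sum_mem [Fact p.Prime] (hg : IsBasicSystem Gs g)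
    (h : IsBasicChain p Gs) {S : Finset ℤ} {z : ℤ → ℤ} {i l : ℤ} (hl : l ∈ S)
    (hz : ∀ n ∈ S, n < l → z n = 0) (hmem : ∑ n ∈ S, z n • g (n + i) ∈ Gs (l + i + 1)) :
    (p : ℤ) ∣ z l := by
  refine hg.dvd_of_zsmul_mem h (n := l + i) ?_
  rw [← Finset.add_sum_erase S _ hl] at hmem
  refine (AddSubgroup.add_mem_cancel_right _ (sum_mem fun n hn => ?_)).1 hmem
  obtain ⟨hne, hn⟩ := Finset.mem_erase.1 hn
  rcases hne.lt_or_gt with hlt | hgt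
  · simp [hz n hn hlt]
  · exact zsmul_mem (hg.mem h (by lia)) _

theorem IsBasicSystem.eq_zero_of_sum_mem [Fact p.Prime] (hg : IsBasicSystem Gs g)
    (h : IsBasicChain p Gs) {m k : ℤ} {z : ℤ → ℤ} (hz : ∀ n, |z n| < p)
    (hmem : ∑ n ∈ Finset.Ico m k, z n • g n ∈ Gs k) : ∀ n ∈ Finset.Ico m k, z n = 0 := by
  intro n hn
  induction n using Int.strongRec (m := m) with
  | lt n hlt => exact absurd (Finset.mem_Ico.1 hn).1 hlt.not_ge
  | ge n _ ih =>
    have hk := (Finset.mem_Ico.1 hn).2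
    refine Int.eq_zero_of_abs_lt_dvd (hg.dvd_of_sum_mem h (i := 0) hn (fun j hj hjn =>
      ih j hjn hj) ?_) (hz n)
    simpa using h.antitone (by lia : n + 1 ≤ k) hmem

theorem IsBasicSystem.bijective_H0 [Fact p.Prime] (hg : IsBasicSystem Gs g)
    (h : IsBasicChain p Gs) : Function.Bijective fun x : H0 p g => (x : G ⧸ Gs 0) := by
  constructor
  · rintro ⟨x, hx⟩ ⟨y, hy⟩ hxy
    obtain ⟨a, ha, hax⟩ := exists_digits_of_mem_H0 hx
    obtain ⟨b, hb, hby⟩ := exists_digits_of_mem_H0 hy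
    obtain ⟨m, rfl, rfl⟩ := (hax.and hby).exists
    have hmem : ∑ n ∈ Finset.Ico m 0, ((a n : ℤ) - b n) • g n ∈ Gs 0 := by
      simpa only [sub_smul, natCast_zsmul, Finset.sum_sub_distrib, neg_add_eq_sub]
        using QuotientAddGroup.eq.1 hxy.symm
    have hzero := hg.eq_zero_of_sum_mem h (fun n => abs_sub_lt_of_nonneg_of_lt
      (Int.natCast_nonneg _) (by exact_mod_cast ha n) (Int.natCast_nonneg _)
      (by exact_mod_cast hb n)) hmem
    refine Subtype.ext (?_ : ∑ n ∈ Finset.Ico m 0, a n • g n = ∑ n ∈ Finset.Ico m 0, b n • g n)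
    refine Finset.sum_congr rfl fun n hn => ?_
    rw [Nat.cast_inj.1 (sub_eq_zero.1 (hzero n hn))]
  · intro q
    obtain ⟨x, rfl⟩ := QuotientAddGroup.mk_surjective q
    obtain ⟨m, hm⟩ := h.exists_mem x
    obtain ⟨a, ha, -, hx⟩ := hg.exists_digits h (h.antitone (min_le_left m 0) hm)
    exact ⟨⟨_, sum_mem_H0 ha _⟩, QuotientAddGroup.eq.2
      (by simpa only [neg_add_eq_sub] using hx 0 (min_le_right m 0))⟩

end Digits

section ShiftSum

variable {G : Type*} [AddCommGroup G] {g : ℤ → G}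

/-- The combination `∑ c_n g_{n+i}` with integer coefficients. Every element with a finite
expansion is of this form with `i = 0`, and the dilation lowers `i` by one; unlike digits, integer
coefficients add without carrying. -/
def shiftSum (g : ℤ → G) (i : ℤ) : (ℤ →₀ ℤ) →+ G :=
  Finsupp.liftAddHom fun n => AddMonoidHom.flip (smulAddHom ℤ G) (g (n + i))

theorem shiftSum_single (i n z : ℤ) : shiftSum g i (Finsupp.single n z) = z • g (n + i) := by
  simp [shiftSum]

theorem shiftSum_apply (i : ℤ) (c : ℤ →₀ ℤ) :
    shiftSum g i c = ∑ n ∈ c.support, c n • g (n + i) := by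
  simp [shiftSum, Finsupp.sum]

variable {p : ℕ}

/-- Uniform carry lets the lowest coefficient, once divisible by `p`, be moved to higher indices
without changing any of the sums `∑ c_n g_{n+i}`. -/
theorem HasUniformCarry.exists_shiftSum_eq (hcarry : HasUniformCarry p g) {c : ℤ →₀ ℤ} {l : ℤ}
    (hc : ∀ n < l, c n = 0) (hl : (p : ℤ) ∣ c l) :
    ∃ c' : ℤ →₀ ℤ, (∀ n < l + 1, c' n = 0) ∧ ∀ i, shiftSum g i c' = shiftSum g i c := by
  obtain ⟨τ, a, ha⟩ := hcarry
  obtain ⟨q, hq⟩ := hl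
  let carried : ℤ →₀ ℤ := ∑ k ∈ Finset.Icc 1 τ, Finsupp.single (l + k) ((a k : ℕ) : ℤ)
  have hcarried : ∀ i, shiftSum g i carried = (p : ℤ) • g (l + i) := fun i => by
    simp only [carried, map_sum, shiftSum_single, natCast_zsmul, ha, add_right_comm l i]
  refine ⟨c.erase l + q • carried, fun n hn => ?_, fun i => ?_⟩
  · have herase : c.erase l n = 0 := by
      rcases eq_or_ne n l with rfl | hne
      · exact Finsupp.erase_same
      · rw [Finsupp.erase_ne hne, hc n (by lia)]
    have hcar : carried n = 0 := by
      rw [Finsupp.finsetSum_apply]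
      refine Finset.sum_eq_zero fun k hk => Finsupp.single_eq_of_ne ?_
      have := (Finset.mem_Icc.1 hk).1
      lia
    simp [herase, hcar]
  · conv_rhs => rw [← Finsupp.single_add_erase l c]
    rw [map_add, map_add, map_zsmul, hcarried, shiftSum_single, smul_smul, hq, mul_comm q, add_comm]

variable [TopologicalSpace G] {Gs : ℤ → AddSubgroup G}

theorem IsBasicSystem.shiftSum_mem_of_forall_lt (hg : IsBasicSystem Gs g) (h : IsBasicChain p Gs)
    {i m : ℤ} {c : ℤ →₀ ℤ} (hc : ∀ n < m, c n = 0) : shiftSum g i c ∈ Gs (m + i) := by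
  rw [shiftSum_apply]
  refine sum_mem fun n hn => zsmul_mem (hg.mem h ?_) _
  have := mt (hc n) (Finsupp.mem_support_iff.1 hn)
  lia

theorem shiftSum_mem [Fact p.Prime] (h : IsBasicChain p Gs) (hg : IsBasicSystem Gs g)
    (hcarry : HasUniformCarry p g) {i j m : ℤ} {c : ℤ →₀ ℤ}
    (hmem : shiftSum g j c ∈ Gs (m + j)) : shiftSum g i c ∈ Gs (m + i) := by
  obtain ⟨l, hl⟩ := c.support.finite_toSet.bddBelow
  have hvanish : ∃ d : ℕ, ∀ n < m - d, c n = 0 := ⟨(m - l).toNat, fun n hn => by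
    by_contra hne
    have := hl (Finsupp.mem_support_iff.2 hne : n ∈ (c.support : Set ℤ))
    lia⟩
  obtain ⟨d, hd⟩ := hvanish
  clear hl
  induction d generalizing c with
  | zero => exact hg.shiftSum_mem_of_forall_lt h (by simpa using hd)
  | succ d ih =>
    have hdvd : (p : ℤ) ∣ c (m - (d + 1 : ℕ)) := by
      by_cases hne : c (m - (d + 1 : ℕ)) = 0
      · exact hne ▸ dvd_zero _
      · have hlow : shiftSum g j c ∈ Gs (m - (d + 1 : ℕ) + j + 1) := h.antitone (by lia) hmem
        rw [shiftSum_apply] at hlow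
        exact hg.dvd_of_sum_mem h (Finsupp.mem_support_iff.2 hne) (fun n _ hn => hd n hn) hlow
    obtain ⟨c', hc', hcc'⟩ := hcarry.exists_shiftSum_eq hd hdvd
    rw [← hcc' j] at hmem
    rw [← hcc' i]
    exact ih hmem (fun n hn => hc' n (by lia))

theorem shiftSum_mem_iff [Fact p.Prime] (h : IsBasicChain p Gs) (hg : IsBasicSystem Gs g)
    (hcarry : HasUniformCarry p g) {i j m : ℤ} {c : ℤ →₀ ℤ} :
    shiftSum g j c ∈ Gs (m + j) ↔ shiftSum g i c ∈ Gs (m + i) :=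
  ⟨shiftSum_mem h hg hcarry, shiftSum_mem h hg hcarry⟩

end ShiftSum

section Topology

variable {G : Type*} [AddCommGroup G] [TopologicalSpace G] {p : ℕ} {Gs : ℤ → AddSubgroup G}
  {g : ℤ → G}

theorem IsBasicSystem.tendsto_cofinite_zero (hg : IsBasicSystem Gs g) (h : IsBasicChain p Gs)
    {a : ℤ → ℕ} {m : ℤ} (ha : ∀ n < m, a n = 0) (i : ℤ) :
    Tendsto (fun n => a n • g (n + i)) cofinite (𝓝 0) := by
  refine h.nhds_basis.tendsto_right_iff.2 fun k _ => ?_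
  refine (Finset.finite_toSet (Finset.Ico m (k - i))).subset fun n hn => ?_
  by_contra hn'
  refine hn ?_
  by_cases hnm : n < m
  · simp [ha n hnm]
  · simp only [Finset.coe_Ico, Set.mem_Ico] at hn'
    exact nsmul_mem (hg.mem h (by lia)) _

variable [IsTopologicalAddGroup G]

theorem IsBasicChain.isOpen (h : IsBasicChain p Gs) (n : ℤ) : IsOpen (Gs n : Set G) :=
  (Gs n).isOpen_of_mem_nhds (h.nhds_basis.mem_of_mem trivial)

theorem IsBasicChain.isClosed (h : IsBasicChain p Gs) (n : ℤ) : IsClosed (Gs n : Set G) :=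
  (Gs n).isClosed_of_isOpen (h.isOpen n)

theorem IsBasicChain.nonarchimedeanAddGroup (h : IsBasicChain p Gs) :
    NonarchimedeanAddGroup G where
  is_nonarchimedean U hU := by
    obtain ⟨n, -, hn⟩ := h.nhds_basis.mem_iff.1 hU
    exact ⟨⟨Gs n, h.isOpen n⟩, hn⟩

theorem IsBasicSystem.exists_isExpansion [Fact p.Prime] (hg : IsBasicSystem Gs g)
    (h : IsBasicChain p Gs) (x : G) : ∃ a, IsExpansion p g a x := by
  obtain ⟨m, hm⟩ := h.exists_mem x
  obtain ⟨a, hap, ham, hx⟩ := hg.exists_digits h hm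
  refine ⟨a, hap, ⟨m, ham⟩, ?_⟩
  rw [HasSum, SummationFilter.unconditional_filter, ← tendsto_sub_nhds_zero_iff,
    h.nhds_basis.tendsto_right_iff]
  refine fun k _ => (eventually_ge_atTop (Finset.Ico m (max k m))).mono fun s hs => ?_
  have htail : ∑ n ∈ s \ Finset.Ico m (max k m), a n • g n ∈ Gs k := by
    refine sum_mem fun n hn => ?_
    simp only [Finset.mem_sdiff, Finset.mem_Ico] at hn
    by_cases hnm : n < m
    · simp [ham n hnm]
    · exact nsmul_mem (hg.mem h (by lia)) _
  rw [← Finset.sum_sdiff hs, add_sub_assoc, ← neg_sub x]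
  exact add_mem htail (neg_mem (h.antitone (le_max_left k m) (hx _ (le_max_right k m))))

end Topology

section Dilation

variable {G : Type*} [AddCommGroup G] [TopologicalSpace G] [IsTopologicalAddGroup G] {p : ℕ}
  {Gs : ℤ → AddSubgroup G} {g : ℤ → G}

/-- The closure in `G × G` of the pairs `(∑ c_n g_n, ∑ c_n g_{n-1})` with integer coefficients. It
turns out to be the graph of the dilation, and being a subgroup it shows that the dilation is
additive, which is not visible on digits because of carries. -/
def dilationGraph (g : ℤ → G) : AddSubgroup (G × G) :=
  ((shiftSum g 0).prod (shiftSum g (-1))).range.topologicalClosure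

theorem mem_dilationGraph_of_hasSum {ι : Type*} {a : ι → ℕ} {e : ι → ℤ} {x y : G}
    (hx : HasSum (fun i => a i • g (e i)) x) (hy : HasSum (fun i => a i • g (e i - 1)) y) :
    (x, y) ∈ dilationGraph g := by
  refine (AddSubgroup.isClosed_topologicalClosure _).mem_of_tendsto (hx.prodMk hy)
    (.of_forall fun s => sum_mem fun i _ => AddSubgroup.le_topologicalClosure _ ?_)
  exact ⟨Finsupp.single (e i) (a i), by simp [shiftSum_single, sub_eq_add_neg]⟩

theorem mem_iff_of_mem_dilationGraph [Fact p.Prime] (h : IsBasicChain p Gs)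
    (hg : IsBasicSystem Gs g) (hcarry : HasUniformCarry p g) {q : G × G}
    (hq : q ∈ dilationGraph g) (k : ℤ) : q.1 ∈ Gs k ↔ q.2 ∈ Gs (k - 1) := by
  have hclosed : IsClosed {q : G × G | q.1 ∈ Gs k ↔ q.2 ∈ Gs (k - 1)} := by
    have hfst : IsClopen {q : G × G | q.1 ∈ Gs k} :=
      IsClopen.preimage ⟨h.isClosed k, h.isOpen k⟩ continuous_fst
    have hsnd : IsClopen {q : G × G | q.2 ∈ Gs (k - 1)} :=
      IsClopen.preimage ⟨h.isClosed _, h.isOpen _⟩ continuous_snd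
    simp only [iff_iff_implies_and_implies]
    exact (isClosed_imp hfst.isOpen hsnd.isClosed).inter (isClosed_imp hsnd.isOpen hfst.isClosed)
  refine closure_minimal ?_ hclosed hq
  rintro _ ⟨c, rfl⟩
  change shiftSum g 0 c ∈ Gs k ↔ shiftSum g (-1) c ∈ Gs (k + -1)
  simpa only [add_zero] using shiftSum_mem_iff h hg hcarry (j := 0) (i := -1) (m := k) (c := c)

theorem eq_zero_iff_of_mem_dilationGraph [Fact p.Prime] (h : IsBasicChain p Gs)
    (hg : IsBasicSystem Gs g) (hcarry : HasUniformCarry p g) {q : G × G}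
    (hq : q ∈ dilationGraph g) : q.1 = 0 ↔ q.2 = 0 := by
  have hmem := mem_iff_of_mem_dilationGraph h hg hcarry hq
  refine ⟨fun hq1 => h.eq_zero _ fun n => ?_, fun hq2 => h.eq_zero _ fun n => ?_⟩
  · simpa [hq1, zero_mem] using hmem (n + 1)
  · simpa [hq2, zero_mem] using hmem n

theorem snd_eq_of_mem_dilationGraph [Fact p.Prime] (h : IsBasicChain p Gs)
    (hg : IsBasicSystem Gs g) (hcarry : HasUniformCarry p g) {x y y' : G}
    (hy : (x, y) ∈ dilationGraph g) (hy' : (x, y') ∈ dilationGraph g) : y = y' :=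
  sub_eq_zero.1 ((eq_zero_iff_of_mem_dilationGraph h hg hcarry (sub_mem hy hy')).1 (sub_self x))

variable [LocallyCompactSpace G]

theorem IsBasicSystem.summable (hg : IsBasicSystem Gs g) (h : IsBasicChain p Gs)
    {a : ℤ → ℕ} {m : ℤ} (ha : ∀ n < m, a n = 0) (i : ℤ) : Summable fun n => a n • g (n + i) := by
  let _ := IsTopologicalAddGroup.rightUniformSpace G
  have := isUniformAddGroup_of_addCommGroup (G := G)
  have := IsRightUniformAddGroup.completeSpace_of_weaklyLocallyCompactSpace (G := G)
  have := h.nonarchimedeanAddGroup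
  exact NonarchimedeanAddGroup.summable_of_tendsto_cofinite_zero (hg.tendsto_cofinite_zero h ha i)

variable [Fact p.Prime] (h : IsBasicChain p Gs) (hg : IsBasicSystem Gs g)
  (hcarry : HasUniformCarry p g)

include h hg in
theorem dilation_mem_dilationGraph (x : G) : (x, dilation p g x) ∈ dilationGraph g := by
  have hex := hg.exists_isExpansion h x
  have hdigit : IsExpansion p g (digit p g x) x := by
    rw [digit, dif_pos hex]
    exact hex.choose_spec
  obtain ⟨m, hm⟩ := hdigit.2.1
  exact mem_dilationGraph_of_hasSum (e := id) hdigit.2.2 (hg.summable h hm (-1)).hasSum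

include h hg in
theorem exists_mem_dilationGraph (y : G) : ∃ x, (x, y) ∈ dilationGraph g := by
  obtain ⟨a, -, ⟨m, hm⟩, ha⟩ := hg.exists_isExpansion h y
  obtain ⟨x, hx⟩ := hg.summable h hm 1
  exact ⟨x, mem_dilationGraph_of_hasSum hx (by simpa only [add_sub_cancel_right] using ha)⟩

include h hg hcarry in
theorem dilation_add (x y : G) : dilation p g (x + y) = dilation p g x + dilation p g y :=
  snd_eq_of_mem_dilationGraph h hg hcarry (dilation_mem_dilationGraph h hg (x + y))
    (add_mem (dilation_mem_dilationGraph h hg x) (dilation_mem_dilationGraph h hg y))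

include h hg hcarry in
theorem dilation_bijective : Function.Bijective (dilation p g) := by
  refine ⟨(injective_iff_map_eq_zero (AddMonoidHom.mk' _ (dilation_add h hg hcarry))).2
    fun x hx => ?_, fun y => ?_⟩
  · exact (eq_zero_iff_of_mem_dilationGraph h hg hcarry (dilation_mem_dilationGraph h hg x)).2 hx
  · obtain ⟨x, hx⟩ := exists_mem_dilationGraph h hg y
    exact ⟨x, snd_eq_of_mem_dilationGraph h hg hcarry (dilation_mem_dilationGraph h hg x) hx⟩

/-- The dilation `𝒜` as an automorphism of `G`. -/
def dilationAut : AddAut G :=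
  AddEquiv.ofBijective (AddMonoidHom.mk' (dilation p g) (dilation_add h hg hcarry))
    (dilation_bijective h hg hcarry)

theorem mem_iff_dilationAut_mem {x : G} {k : ℤ} :
    x ∈ Gs k ↔ dilationAut h hg hcarry x ∈ Gs (k - 1) :=
  mem_iff_of_mem_dilationGraph h hg hcarry (dilation_mem_dilationGraph h hg x) k

theorem dilationPow_eq_zsmul (n : ℤ) : dilationPow p g n = ⇑(n • dilationAut h hg hcarry) := by
  set A := dilationAut h hg hcarry
  have hinv : Function.invFun (dilation p g) = ⇑(-A : AddAut G) :=
    Function.invFun_eq_of_injective_of_rightInverse A.injective A.apply_symm_apply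
  have hiter : ∀ (B : AddAut G) (k : ℕ), ⇑(k • B) = B^[k] := fun B k => by
    induction k with
    | zero => rw [zero_nsmul]; rfl
    | succ k ih => ext x; rw [succ_nsmul, AddAut.add_apply, ih, Function.iterate_succ_apply]
  cases n with
  | ofNat k => rw [Int.ofNat_eq_natCast, natCast_zsmul, hiter]; rfl
  | negSucc k => rw [negSucc_zsmul, ← neg_nsmul, hiter, dilationPow, hinv]

theorem mem_iff_zsmul_dilationAut_mem {x : G} {k n : ℤ} :
    x ∈ Gs k ↔ (n • dilationAut h hg hcarry) x ∈ Gs (k - n) := by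
  induction n using Int.induction_on generalizing x k with
  | zero => simp
  | succ n ih =>
    rw [add_zsmul, one_zsmul, AddAut.add_apply, mem_iff_dilationAut_mem h hg hcarry, ih]
    congr! 2
    ring
  | pred n ih =>
    have hA : dilationAut h hg hcarry + (-(n : ℤ) - 1) • dilationAut h hg hcarry
        = -(n : ℤ) • dilationAut h hg hcarry := by
      rw [← one_add_zsmul]
      congr 1
      ring
    rw [ih, mem_iff_dilationAut_mem h hg hcarry (x := ((-(n : ℤ) - 1) • _ : AddAut G) x),
      ← AddAut.add_apply, hA]
    congr! 2
    ring

end Dilation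

section Pairing

variable {G : Type*} [AddCommGroup G] [TopologicalSpace G]

theorem pair_add (χ : Chars G) (x y : G) : pair χ (x + y) = pair χ x * pair χ y := by
  simp only [pair, ofAdd_add, map_mul, Circle.coe_mul]

theorem pair_nsmul (χ : Chars G) (a : ℕ) (x : G) : pair χ (a • x) = pair χ x ^ a := by
  simp only [pair, ofAdd_nsmul, map_pow, Circle.coe_pow]

theorem norm_pair (χ : Chars G) (x : G) : ‖pair χ x‖ = 1 := Circle.norm_coe _

theorem pair_neg (χ : Chars G) (x : G) : pair χ (-x) = conj (pair χ x) := by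
  simp only [pair, ofAdd_neg, map_inv, Circle.coe_inv_eq_conj]

theorem pair_sub (χ : Chars G) (x y : G) : pair χ (x - y) = pair χ x * conj (pair χ y) := by
  rw [sub_eq_add_neg, pair_add, pair_neg]

theorem pair_one (x : G) : pair (1 : Chars G) x = 1 := rfl

theorem pair_mul (χ η : Chars G) (x : G) : pair (χ * η) x = pair χ x * pair η x := rfl

theorem pair_inv (χ : Chars G) (x : G) : pair χ⁻¹ x = conj (pair χ x) :=
  Circle.coe_inv_eq_conj _

theorem ext_pair {χ η : Chars G} (h : ∀ x, pair χ x = pair η x) : χ = η :=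
  PontryaginDual.ext fun x => Circle.ext (h x.toAdd)

theorem continuous_pair (χ : Chars G) : Continuous (pair χ) :=
  continuous_induced_dom.comp ((map_continuous χ).comp continuous_ofAdd)

theorem continuous_pair_left (x : G) : Continuous fun χ : Chars G => pair χ x :=
  continuous_induced_dom.comp
    (continuous_eval_const (F := Multiplicative G →ₜ* Circle) (Multiplicative.ofAdd x))

/-- The annihilator `H^⊥` of a subgroup `H`, as a subgroup of the character group. The set
`annihilator Gs n` is by definition the carrier of `ann (Gs n)`. -/
def ann (H : AddSubgroup G) : Subgroup (Chars G) where
  carrier := {χ | ∀ x ∈ H, pair χ x = 1}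
  mul_mem' {a b} ha hb x hx := by rw [pair_mul, ha x hx, hb x hx, one_mul]
  one_mem' x _ := pair_one x
  inv_mem' {a} ha x hx := by rw [pair_inv, ha x hx, map_one]

theorem mem_ann {H : AddSubgroup G} {χ : Chars G} : χ ∈ ann H ↔ ∀ x ∈ H, pair χ x = 1 := Iff.rfl

theorem ann_anti {H K : AddSubgroup G} (hHK : H ≤ K) : ann K ≤ ann H :=
  fun _ hχ x hx => hχ x (hHK hx)

theorem isOpen_ann {H : AddSubgroup G} (hH : IsCompact (H : Set G)) :
    IsOpen (ann H : Set (Chars G)) := by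
  have : CompactSpace (Multiplicative H) := isCompact_iff_compactSpace.1 hH
  let incl : Multiplicative H →ₜ* Multiplicative G :=
    ⟨AddMonoidHom.toMultiplicative H.subtype,
      continuous_ofAdd.comp (continuous_subtype_val.comp continuous_toAdd)⟩
  have hker : (ann H : Set (Chars G)) = PontryaginDual.map incl ⁻¹' {1} := by
    ext χ
    refine ⟨fun hχ => PontryaginDual.ext fun x => Circle.ext (hχ _ x.toAdd.2), fun hχ x hx => ?_⟩
    exact congrArg (fun η => ((η (Multiplicative.ofAdd ⟨x, hx⟩) : Circle) : ℂ)) hχ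
  rw [hker]
  exact (isOpen_discrete _).preimage (map_continuous _)

end Pairing

section FiniteIndex

theorem image_subtype_preimage {α : Type*} {s t : Set α} (hst : s ⊆ t) :
    ((↑) : t → α) '' ((↑) ⁻¹' s) = s := by
  rw [Subtype.image_preimage_coe, Set.inter_eq_right.2 hst]

theorem isCompact_of_relIndex_ne_zero {Γ : Type*} [AddGroup Γ] [TopologicalSpace Γ]
    [IsTopologicalAddGroup Γ] {H K : AddSubgroup Γ} (hH : IsCompact (H : Set Γ)) (hHK : H ≤ K)
    (hfin : H.relIndex K ≠ 0) : IsCompact (K : Set Γ) := by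
  have : (H.addSubgroupOf K).FiniteIndex := ⟨hfin⟩
  obtain ⟨s, hs, -⟩ := (H.addSubgroupOf K).exists_isComplement_left 0
  have hs' : Finite s := hs.finite_left_iff.2 inferInstance
  have hsub : IsCompact (H.addSubgroupOf K : Set K) := by
    rw [Subtype.isCompact_iff]
    exact (image_subtype_preimage hHK).symm ▸ hH
  rw [isCompact_iff_isCompact_univ, ← hs.add_eq]
  exact s.toFinite.isCompact.add hsub

variable {Γ : Type*} [Group Γ] [MeasurableSpace Γ] [MeasurableMul Γ] {H K : Subgroup Γ}

@[to_additive addRelIndex_mul_measureReal]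
theorem relIndex_mul_measureReal (hH : MeasurableSet (H : Set Γ)) (hK : MeasurableSet (K : Set Γ))
    (hHK : H ≤ K) (hfin : H.relIndex K ≠ 0) (m : Measure Γ) [m.IsMulLeftInvariant] :
    H.relIndex K * m.real H = m.real K := by
  have : (H.subgroupOf K).FiniteIndex := ⟨hfin⟩
  have : MeasurableMul K :=
    ⟨fun c => ((measurable_const_mul (c : Γ)).comp measurable_subtype_coe).subtype_mk,
      fun c => ((measurable_mul_const (c : Γ)).comp measurable_subtype_coe).subtype_mk⟩
  have hemb : MeasurableEmbedding K.subtype := MeasurableEmbedding.subtype_coe hK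
  have := Measure.IsMulLeftInvariant.comap m hemb
  have hcomapH : m.comap K.subtype (H.subgroupOf K) = m H :=
    (hemb.comap_apply _ _).trans (congrArg m (image_subtype_preimage hHK))
  have hcomapK : m.comap K.subtype Set.univ = m K :=
    (hemb.comap_apply _ _).trans (congrArg m (Set.image_univ.trans Subtype.range_coe))
  have hindex := (H.subgroupOf K).index_mul_measure (hH.preimage measurable_subtype_coe)
    (m.comap K.subtype)
  rw [hcomapH, hcomapK] at hindex
  exact (ENNReal.toReal_mul.trans (by rw [ENNReal.toReal_natCast]; rfl)).symm.trans
    (congrArg ENNReal.toReal hindex)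

@[to_additive]
theorem setIntegral_eq_zero_of_map_mul_left (m : Measure Γ)
    [m.IsMulLeftInvariant] {φ : Γ → ℂ} {t : Γ} (ht : t ∈ H) {c : ℂ} (hc : c ≠ 1)
    (hφ : ∀ x, φ (t * x) = c * φ x) : ∫ x in (H : Set Γ), φ x ∂m = 0 := by
  have hpre : (t * ·) ⁻¹' (H : Set Γ) = H := Set.ext fun x => H.mul_mem_cancel_left ht
  have htranslate : ∫ x in (H : Set Γ), φ (t * x) ∂m = ∫ x in (H : Set Γ), φ x ∂m := by
    conv_lhs => rw [← hpre]
    exact (measurePreserving_mul_left m t).setIntegral_preimage_emb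
      (measurableEmbedding_mulLeft t) φ _
  simp only [hφ, integral_const_mul] at htranslate
  exact (mul_left_eq_self₀.1 htranslate).resolve_left hc

end FiniteIndex

section ChainDual

variable {G : Type*} [AddCommGroup G] [TopologicalSpace G] {p : ℕ} {Gs : ℤ → AddSubgroup G}
  {g : ℤ → G} {r : ℤ → Chars G}

theorem IsBasicChain.exists_mem_ann (h : IsBasicChain p Gs) (χ : Chars G) (m : ℤ) :
    ∃ n ≥ m, χ ∈ ann (Gs n) := by
  have hcont : Tendsto (fun x : G => χ (Multiplicative.ofAdd x)) (𝓝 0) (𝓝 1) := by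
    rw [← map_one χ, ← ofAdd_zero]
    exact ((map_continuous χ).comp continuous_ofAdd).tendsto 0
  have hone : Circle.centeredArc (Real.pi / 2) ∈ 𝓝 (1 : Circle) :=
    (Circle.isOpen_centeredArc _).mem_nhds <| by
      rw [Circle.mem_centeredArc (by linarith [Real.pi_pos])]
      simp [Real.pi_pos]
  obtain ⟨n, -, hn⟩ := h.nhds_basis.mem_iff.1 (hcont hone)
  refine ⟨max m n, le_max_left m n, fun x hx => ?_⟩
  -- The circle has no non-trivial subgroup inside the open right half-plane.
  rw [pair, Circle.coe_eq_one]
  refine Circle.eq_one_of_forall_pow_mem_centeredArc_pi_div_two fun k _ => ?_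
  rw [← map_pow, ← ofAdd_nsmul]
  exact hn (AddSubgroup.nsmul_mem _ (h.antitone (le_max_right m n) hx) k)

theorem IsBasicSystem.pair_pow_eq_one (hg : IsBasicSystem Gs g) (h : IsBasicChain p Gs) {n : ℤ}
    {χ : Chars G} (hχ : χ ∈ ann (Gs (n + 1))) : pair χ (g n) ^ p = 1 := by
  rw [← pair_nsmul]
  exact hχ _ (h.nsmul_mem (hg n).1)

variable [Fact p.Prime]

theorem IsBasicChain.isCompact [IsTopologicalAddGroup G] [LocallyCompactSpace G]
    (h : IsBasicChain p Gs) (n : ℤ) : IsCompact (Gs n : Set G) := by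
  obtain ⟨C, hC, hC0⟩ := exists_compact_mem_nhds (0 : G)
  obtain ⟨m, -, hm⟩ := h.nhds_basis.mem_iff.1 hC0
  have hle : Gs (n + (m - n).toNat) ≤ Gs m := h.antitone (by omega)
  refine isCompact_of_relIndex_ne_zero (hC.of_isClosed_subset (h.isClosed _)
    ((SetLike.coe_subset_coe.2 hle).trans hm)) (h.antitone (by omega)) ?_
  rw [h.relIndex_add]
  exact pow_ne_zero _ (Fact.out : p.Prime).ne_zero

theorem IsBasicSystem.mem_ann_of_succ (hg : IsBasicSystem Gs g) (h : IsBasicChain p Gs) {n : ℤ}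
    {χ : Chars G} (hχ : χ ∈ ann (Gs (n + 1))) (hχg : pair χ (g n) = 1) : χ ∈ ann (Gs n) := by
  intro x hx
  obtain ⟨a, -, ha⟩ := hg.exists_digit h hx
  rw [← sub_add_cancel x (a • g n), pair_add, hχ _ ha, pair_nsmul, hχg, one_pow, one_mul]

theorem IsRademacher.isPrimitiveRoot (hr : IsRademacher Gs r) (h : IsBasicChain p Gs)
    (hg : IsBasicSystem Gs g) (n : ℤ) : IsPrimitiveRoot (pair (r n) (g n)) p :=
  orderOf_eq_prime (hg.pair_pow_eq_one h (hr n).1)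
    (fun he => (hr n).2 (hg.mem_ann_of_succ h (hr n).1 he)) ▸ IsPrimitiveRoot.orderOf _

theorem IsRademacher.exists_pair_ne_one (hr : IsRademacher Gs r) (h : IsBasicChain p Gs)
    (hg : IsBasicSystem Gs g) {j : ℤ} {x : G} (hx : x ∉ Gs j) :
    ∃ η ∈ ann (Gs j), pair η x ≠ 1 := by
  obtain ⟨m, hm⟩ := h.exists_mem x
  have hlt : ∀ n, x ∈ Gs n → n < j := fun n hn => by
    by_contra! hjn
    exact hx (h.antitone hjn hn)
  obtain ⟨n, hn, hmax⟩ := Int.exists_greatest_of_bdd ⟨j, fun n hn => (hlt n hn).le⟩ ⟨m, hm⟩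
  refine ⟨r n, ann_anti (h.antitone (hlt n hn)) (hr n).1, fun he => ?_⟩
  obtain ⟨a, hap, ha⟩ := hg.exists_digit h hn
  rw [← sub_add_cancel x (a • g n), pair_add, (hr n).1 _ ha, pair_nsmul, one_mul] at he
  have hdvd := (hr.isPrimitiveRoot h hg n).dvd_of_pow_eq_one _ he
  rw [Nat.eq_zero_of_dvd_of_lt hdvd hap, zero_smul, sub_zero] at ha
  exact (lt_add_one n).not_ge (hmax _ ha)

theorem IsRademacher.relIndex_ann (hr : IsRademacher Gs r) (h : IsBasicChain p Gs)
    (hg : IsBasicSystem Gs g) (n : ℤ) : (ann (Gs n)).relIndex (ann (Gs (n + 1))) = p := by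
  have hζ := hr.isPrimitiveRoot h hg n
  let eval : Chars G →* Circle :=
    { toFun := fun χ => χ (Multiplicative.ofAdd (g n))
      map_one' := rfl
      map_mul' := fun _ _ => rfl }
  have hker : ann (Gs n) = eval.ker ⊓ ann (Gs (n + 1)) :=
    le_antisymm (le_inf (fun χ hχ => Circle.ext (hχ _ (hg n).1)) (ann_anti (h.succ_le n)))
      fun χ hχ => hg.mem_ann_of_succ h hχ.2 (congrArg Circle.coeHom hχ.1)
  have hmap : (ann (Gs (n + 1))).map eval = Subgroup.zpowers (eval (r n)) := by
    refine le_antisymm ?_ (Subgroup.zpowers_le.2 (Subgroup.mem_map_of_mem _ (hr n).1))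
    rintro _ ⟨χ, hχ, rfl⟩
    obtain ⟨i, -, hi⟩ := hζ.eq_pow_of_pow_eq_one (hg.pair_pow_eq_one h hχ)
    have : eval (r n) ^ i = eval χ := Circle.ext ((Circle.coe_pow _ _).trans hi)
    exact this ▸ Subgroup.npow_mem_zpowers _ _
  have horder : orderOf (eval (r n)) = p :=
    (orderOf_injective Circle.coeHom Circle.coe_injective _).symm.trans hζ.eq_orderOf.symm
  rw [hker, Subgroup.inf_relIndex_right, Subgroup.relIndex_ker, hmap, Nat.card_zpowers, horder]

end ChainDual

section CharDil

open scoped Pointwise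

variable {G : Type*} [AddCommGroup G] [TopologicalSpace G]

theorem dualCoset_eq_smul {p : ℕ} (Gs : ℤ → AddSubgroup G) (r : ℤ → Chars G) (γ : ℤ → Fin p)
    (l u : ℤ) : dualCoset Gs r γ l u =
      (∏ k ∈ Finset.Icc l u, r k ^ (γ k : ℕ)) • (ann (Gs l) : Set (Chars G)) :=
  Set.ext fun _ => exists_congr fun η => and_congr_right fun _ => by
    rw [mul_comm, eq_comm]; rfl

variable [IsTopologicalAddGroup G] [LocallyCompactSpace G] {p : ℕ} [Fact p.Prime]
  {Gs : ℤ → AddSubgroup G} {g : ℤ → G} (h : IsBasicChain p Gs) (hg : IsBasicSystem Gs g)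
  (hcarry : HasUniformCarry p g)
include h hg hcarry

theorem continuous_zsmul_dilationAut (n : ℤ) : Continuous (n • dilationAut h hg hcarry) := by
  refine continuous_of_continuousAt_zero (n • dilationAut h hg hcarry) ?_
  rw [ContinuousAt, map_zero, h.nhds_basis.tendsto_iff h.nhds_basis]
  exact fun k _ => ⟨k + n, trivial, fun x hx => by
    simpa using (mem_iff_zsmul_dilationAut_mem h hg hcarry (n := n)).1 hx⟩

theorem pair_charDil (n : ℤ) (χ : Chars G) (x : G) :
    pair (charDil p g n χ) x = pair χ ((n • dilationAut h hg hcarry) x) := by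
  have hex : ∃ η : Chars G, ∀ x, pair η x = pair χ (dilationPow p g n x) := by
    let A : Multiplicative G →ₜ* Multiplicative G :=
      ⟨AddMonoidHom.toMultiplicative (n • dilationAut h hg hcarry : AddAut G).toAddMonoidHom,
        continuous_ofAdd.comp
          ((continuous_zsmul_dilationAut h hg hcarry n).comp continuous_toAdd)⟩
    rw [dilationPow_eq_zsmul h hg hcarry]
    exact ⟨PontryaginDual.map A χ, fun x => rfl⟩
  rw [charDil, dif_pos hex, hex.choose_spec, dilationPow_eq_zsmul h hg hcarry]

theorem charDil_mul (n : ℤ) (χ η : Chars G) :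
    charDil p g n (χ * η) = charDil p g n χ * charDil p g n η :=
  ext_pair fun x => by simp only [pair_mul, pair_charDil h hg hcarry]

theorem charDil_zero (χ : Chars G) : charDil p g 0 χ = χ :=
  ext_pair fun x => by rw [pair_charDil h hg hcarry, zero_zsmul]; rfl

theorem charDil_add (m n : ℤ) (χ : Chars G) :
    charDil p g (m + n) χ = charDil p g n (charDil p g m χ) :=
  ext_pair fun x => by simp only [pair_charDil h hg hcarry, add_zsmul, AddAut.add_apply]

theorem mem_ann_iff_charDil_mem {n k : ℤ} {χ : Chars G} :
    χ ∈ ann (Gs k) ↔ charDil p g n χ ∈ ann (Gs (n + k)) := by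
  simp only [mem_ann, pair_charDil h hg hcarry]
  refine ⟨fun hχ x hx => hχ _ ?_, fun hχ x hx => ?_⟩
  · simpa using (mem_iff_zsmul_dilationAut_mem h hg hcarry (n := n)).1 hx
  · obtain ⟨y, rfl⟩ := (n • dilationAut h hg hcarry).surjective x
    refine hχ y ((mem_iff_zsmul_dilationAut_mem h hg hcarry (n := n)).2 ?_)
    simpa using hx

theorem charDil_bijective (n : ℤ) : Function.Bijective (charDil p g n) := by
  refine Function.bijective_iff_has_inverse.2 ⟨charDil p g (-n), fun χ => ?_, fun χ => ?_⟩ <;>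
  simp [← charDil_add h hg hcarry, charDil_zero h hg hcarry]

theorem image_charDil_smul (n k : ℤ) (ρ : Chars G) :
    charDil p g n '' (ρ • (ann (Gs k) : Set (Chars G))) =
      charDil p g n ρ • (ann (Gs (n + k)) : Set (Chars G)) := by
  have hann : charDil p g n '' ann (Gs k) = ann (Gs (n + k)) := by
    refine Set.Subset.antisymm ?_ fun χ hχ => ?_
    · exact Set.image_subset_iff.2 fun χ hχ => (mem_ann_iff_charDil_mem h hg hcarry).1 hχ
    · obtain ⟨η, rfl⟩ := (charDil_bijective h hg hcarry n).2 χ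
      exact ⟨η, (mem_ann_iff_charDil_mem h hg hcarry).2 hχ, rfl⟩
  rw [← hann, ← Set.image_smul, ← Set.image_smul, Set.image_image, Set.image_image]
  exact Set.image_congr fun η _ => charDil_mul h hg hcarry n ρ η

variable {r : ℤ → Chars G}

theorem charDil_apply_of_succ (hshift : ∀ k, charDil p g 1 (r k) = r (k + 1)) (n k : ℤ) :
    charDil p g n (r k) = r (n + k) := by
  induction n using Int.induction_on generalizing k with
  | zero => rw [charDil_zero h hg hcarry, zero_add]
  | succ n ih => rw [add_comm (n : ℤ), charDil_add h hg hcarry, hshift, ih]; congr 1; ring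
  | pred n ih =>
    rw [← sub_add_cancel k 1, ← hshift, ← charDil_add h hg hcarry, add_sub_cancel, ih]
    congr 1; ring

theorem image_charDil_dualCoset (hshift : ∀ k, charDil p g 1 (r k) = r (k + 1))
    (γ : ℤ → Fin p) (n l u : ℤ) :
    charDil p g n '' dualCoset Gs r γ l u =
      dualCoset Gs r (fun k => γ (k - n)) (n + l) (n + u) := by
  let D : Chars G →* Chars G := .mk' (charDil p g n) (charDil_mul h hg hcarry n)
  have hprod : charDil p g n (∏ k ∈ Finset.Icc l u, r k ^ (γ k : ℕ)) =
      ∏ k ∈ Finset.Icc (n + l) (n + u), r k ^ (γ (k - n) : ℕ) := by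
    rw [← Finset.image_add_left_Icc, Finset.prod_image (add_right_injective n).injOn]
    refine (map_prod D _ _).trans (Finset.prod_congr rfl fun k _ => ?_)
    rw [map_pow, add_sub_cancel_left, ← charDil_apply_of_succ h hg hcarry hshift]
    rfl
  rw [dualCoset_eq_smul, dualCoset_eq_smul, image_charDil_smul h hg hcarry, hprod]

end CharDil

section Coset

variable {G : Type*} [AddCommGroup G]

/-- The coset `q ∈ G / H` as a subset of `G`. -/
abbrev coset {H : AddSubgroup G} (q : G ⧸ H) : Set G := QuotientAddGroup.mk ⁻¹' {q}

theorem mem_coset_mk {H : AddSubgroup G} {x y : G} : x ∈ coset (y : G ⧸ H) ↔ x - y ∈ H :=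
  QuotientAddGroup.eq_iff_sub_mem

theorem coset_zero {H : AddSubgroup G} : coset (0 : G ⧸ H) = H := by
  ext x
  rw [← QuotientAddGroup.mk_zero, mem_coset_mk, sub_zero, SetLike.mem_coe]

variable [TopologicalSpace G]

theorem pair_eq_pair_out {H : AddSubgroup G} {q : G ⧸ H} {x : G} (hx : x ∈ coset q)
    {η : Chars G} (hη : η ∈ ann H) : pair η x = pair η q.out := by
  rw [← QuotientAddGroup.out_eq' q, mem_coset_mk] at hx
  rw [← sub_add_cancel x q.out, pair_add, hη _ hx, one_mul]

variable [IsTopologicalAddGroup G]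

theorem isOpen_preimage_mk {H : AddSubgroup G} (hH : IsOpen (H : Set G)) (s : Set (G ⧸ H)) :
    IsOpen ((QuotientAddGroup.mk : G → G ⧸ H) ⁻¹' s) := by
  have := QuotientAddGroup.discreteTopology hH
  exact (isOpen_discrete s).preimage QuotientAddGroup.continuous_mk

theorem measure_coset [MeasurableSpace G] [BorelSpace G] (μ : Measure G)
    [μ.IsAddLeftInvariant] {H : AddSubgroup G} (q : G ⧸ H) : μ (coset q) = μ H := by
  obtain ⟨y, rfl⟩ := QuotientAddGroup.mk_surjective q
  rw [← measure_preimage_add μ (-y) (H : Set G)]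
  congr 1
  ext x
  rw [mem_coset_mk, sub_eq_neg_add]
  rfl

end Coset

section ChainCosets

variable {G : Type*} [AddCommGroup G] [TopologicalSpace G] {p : ℕ} {Gs : ℤ → AddSubgroup G}

theorem IsBasicChain.iUnion_neg (h : IsBasicChain p Gs) :
    ⋃ k : ℕ, (Gs (-(k : ℤ)) : Set G) = Set.univ :=
  Set.iUnion_eq_univ_iff.2 fun x => by
    obtain ⟨m, hm⟩ := h.exists_mem x
    exact ⟨(-m).toNat, h.antitone (by omega) hm⟩

/-- The cosets of all the subgroups of a chain; they form a π-system and a basis of the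
topology. -/
def chainCosets (Gs : ℤ → AddSubgroup G) : Set (Set G) :=
  Set.range fun i : Σ j, G ⧸ Gs j => coset i.2

theorem IsBasicChain.inter_coset (h : IsBasicChain p Gs) {i j : ℤ} (q : G ⧸ Gs i)
    (q' : G ⧸ Gs j) (hne : (coset q ∩ coset q').Nonempty) :
    coset q ∩ coset q' = coset q ∨ coset q ∩ coset q' = coset q' := by
  obtain ⟨x, rfl, rfl⟩ := hne
  rcases le_total i j with hij | hji
  · exact Or.inr (Set.inter_eq_right.2 fun y hy =>
      mem_coset_mk.2 (h.antitone hij (mem_coset_mk.1 hy)))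
  · exact Or.inl (Set.inter_eq_left.2 fun y hy =>
      mem_coset_mk.2 (h.antitone hji (mem_coset_mk.1 hy)))

theorem IsBasicChain.isPiSystem_chainCosets (h : IsBasicChain p Gs) :
    IsPiSystem (chainCosets Gs) := by
  rintro _ ⟨i, rfl⟩ _ ⟨i', rfl⟩ hne
  rcases h.inter_coset i.2 i'.2 hne with he | he
  · exact ⟨i, he.symm⟩
  · exact ⟨i', he.symm⟩

variable [IsTopologicalAddGroup G]

theorem IsBasicChain.isTopologicalBasis_chainCosets (h : IsBasicChain p Gs) :
    TopologicalSpace.IsTopologicalBasis (chainCosets Gs) := by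
  refine TopologicalSpace.isTopologicalBasis_of_isOpen_of_nhds ?_ fun x U hx hU => ?_
  · rintro _ ⟨i, rfl⟩
    exact isOpen_preimage_mk (h.isOpen i.1) _
  · have htranslate : Tendsto (x + ·) (𝓝 0) (𝓝 x) := by
      simpa using (continuous_const_add x).tendsto (0 : G)
    obtain ⟨j, -, hj⟩ := h.nhds_basis.mem_iff.1 (htranslate (hU.mem_nhds hx))
    refine ⟨_, ⟨⟨j, (x : G ⧸ Gs j)⟩, rfl⟩, rfl, fun y hy => ?_⟩
    simpa using hj (mem_coset_mk.1 hy)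

theorem IsBasicChain.measurableSet [MeasurableSpace G] [BorelSpace G] (h : IsBasicChain p Gs)
    (n : ℤ) : MeasurableSet (Gs n : Set G) := (h.isOpen n).measurableSet

variable [LocallyCompactSpace G] [Fact p.Prime]

theorem IsBasicChain.exists_exhaustion (h : IsBasicChain p Gs) (j : ℤ) :
    ∃ Q : ℕ → Finset (G ⧸ Gs j), Monotone Q ∧ (∀ q, ∃ k, q ∈ Q k) ∧
      ∀ k : ℕ, -(k : ℤ) ≤ j → (QuotientAddGroup.mk ⁻¹' (Q k : Set (G ⧸ Gs j)) : Set G) =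
        Gs (-(k : ℤ)) := by
  have hfin (k : ℕ) : ((QuotientAddGroup.mk : G → G ⧸ Gs j) '' Gs (-(k : ℤ))).Finite := by
    have := QuotientAddGroup.discreteTopology (h.isOpen j)
    exact ((h.isCompact _).image QuotientAddGroup.continuous_mk).finite_of_discrete
  refine ⟨fun k => (hfin k).toFinset, fun k l hkl => ?_, fun q => ?_, fun k hk => ?_⟩
  · exact Set.Finite.toFinset_mono (Set.image_mono (h.antitone (by omega)))
  · obtain ⟨x, rfl⟩ := QuotientAddGroup.mk_surjective q
    obtain ⟨k, hk⟩ := Set.mem_iUnion.1 (h.iUnion_neg.symm ▸ Set.mem_univ x)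
    exact ⟨k, (hfin k).mem_toFinset.2 ⟨x, hk, rfl⟩⟩
  · rw [Set.Finite.coe_toFinset]
    refine Set.Subset.antisymm ?_ (Set.subset_preimage_image _ _)
    rintro x ⟨y, hy, hyx⟩
    have := sub_mem hy (h.antitone hk (QuotientAddGroup.eq_iff_sub_mem.1 hyx))
    rwa [sub_sub_cancel] at this

theorem IsBasicChain.secondCountableTopology (h : IsBasicChain p Gs) :
    SecondCountableTopology G := by
  have hcountable (j : ℤ) : Countable (G ⧸ Gs j) := by
    obtain ⟨Q, -, hQ, -⟩ := h.exists_exhaustion j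
    rw [← Set.countable_univ_iff, ← Set.iUnion_eq_univ_iff.2 hQ]
    exact Set.countable_iUnion fun k => (Q k).countable_toSet
  exact h.isTopologicalBasis_chainCosets.secondCountableTopology (Set.countable_range _)

end ChainCosets

section Uniqueness

theorem ae_eq_zero_of_isPiSystem {α E : Type*} [mα : MeasurableSpace α] [NormedAddCommGroup E]
    [NormedSpace ℝ E] [CompleteSpace E] {m : Measure α} {f : α → E} (hf : Integrable f m)
    {C : Set (Set α)} (hgen : mα = MeasurableSpace.generateFrom C) (hC : IsPiSystem C)
    (h0 : ∀ s ∈ C, ∫ x in s, f x ∂m = 0) (huniv : ∫ x, f x ∂m = 0) : f =ᵐ[m] 0 := by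
  refine hf.ae_eq_of_withDensityᵥ_eq (integrable_zero _ _ _) ?_
  rw [withDensityᵥ_zero]
  refine VectorMeasure.ext_of_generateFrom C (fun s hs => ?_) hgen hC ?_
  · rw [withDensityᵥ_apply hf (hgen ▸ MeasurableSpace.measurableSet_generateFrom hs), h0 s hs]
    rfl
  · rw [withDensityᵥ_apply hf .univ, setIntegral_univ, huniv]
    rfl

theorem IsBasicChain.ae_eq_zero_of_setIntegral_coset {G : Type*} [AddCommGroup G]
    [TopologicalSpace G] [IsTopologicalAddGroup G] [LocallyCompactSpace G] [MeasurableSpace G]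
    [BorelSpace G] {p : ℕ} [Fact p.Prime] {Gs : ℤ → AddSubgroup G} (h : IsBasicChain p Gs)
    {μ : Measure G} {f : G → ℂ} (hf : ∀ n, IntegrableOn f (Gs n) μ)
    (h0 : ∀ j (q : G ⧸ Gs j), ∫ x in coset q, f x ∂μ = 0) : f =ᵐ[μ] 0 := by
  have := h.secondCountableTopology
  have hgen : ‹MeasurableSpace G› = MeasurableSpace.generateFrom (chainCosets Gs) :=
    (BorelSpace.measurable_eq (α := G)).trans h.isTopologicalBasis_chainCosets.borel_eq_generateFrom
  rw [← Measure.restrict_univ (μ := μ), ← h.iUnion_neg, EventuallyEq, ae_restrict_iUnion_iff]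
  refine fun k => ae_eq_zero_of_isPiSystem (hf _) hgen h.isPiSystem_chainCosets ?_ ?_
  · rintro _ ⟨i, rfl⟩
    rw [Measure.restrict_restrict (isOpen_preimage_mk (h.isOpen _) _).measurableSet, ← coset_zero]
    rcases (coset i.2 ∩ coset (0 : G ⧸ Gs (-(k : ℤ)))).eq_empty_or_nonempty with he | hne
    · rw [he, setIntegral_empty]
    · rcases h.inter_coset _ _ hne with he | he <;> simp only [he, h0]
  · rw [← coset_zero, h0]

end Uniqueness

section ChainMeasures

theorem eq_zpow_of_succ {K : Type*} [Field K] {a : K} (ha : a ≠ 0) {f : ℤ → K} (h0 : f 0 = 1)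
    (hf : ∀ n, f (n + 1) = a * f n) (n : ℤ) : f n = a ^ n := by
  induction n using Int.induction_on with
  | zero => rw [h0, zpow_zero]
  | succ n ih => rw [hf, ih, zpow_add_one₀ ha, mul_comm]
  | pred n ih =>
    have hpred := hf (-(n : ℤ) - 1)
    rw [sub_add_cancel, ih] at hpred
    rw [zpow_sub_one₀ ha, hpred, mul_comm a, mul_inv_cancel_right₀ ha]

variable {G : Type*} [AddCommGroup G] [TopologicalSpace G] [IsTopologicalAddGroup G] {p : ℕ}
  [hp : Fact p.Prime] {Gs : ℤ → AddSubgroup G} {g : ℤ → G} [MeasurableSpace G] [BorelSpace G]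

theorem IsBasicChain.measureReal (h : IsBasicChain p Gs) {μ : Measure G} [μ.IsAddLeftInvariant]
    (hμ : μ (Gs 0 : Set G) = 1) (n : ℤ) : μ.real (Gs n : Set G) = (p : ℝ) ^ (-n) := by
  have hp0 : (p : ℝ) ≠ 0 := Nat.cast_ne_zero.2 hp.out.ne_zero
  rw [← inv_zpow']
  refine eq_zpow_of_succ (f := fun n => μ.real (Gs n : Set G)) (inv_ne_zero hp0) ?_ (fun n => ?_) n
  · simp only [measureReal_def, hμ, ENNReal.toReal_one]
  · rw [eq_inv_mul_iff_mul_eq₀ hp0, ← h.relIndex_eq n]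
    exact addRelIndex_mul_measureReal (h.measurableSet _) (h.measurableSet _) (h.succ_le n)
      (h.relIndex_eq n ▸ hp.out.ne_zero) μ

theorem quasiMeasurePreserving_zsmul_dilationAut [LocallyCompactSpace G]
    (h : IsBasicChain p Gs) (hg : IsBasicSystem Gs g) (hcarry : HasUniformCarry p g)
    (μ : Measure G) [μ.IsAddHaarMeasure] (n : ℤ) :
    Measure.QuasiMeasurePreserving (n • dilationAut h hg hcarry) μ μ := by
  have := h.secondCountableTopology
  have hcont := continuous_zsmul_dilationAut h hg hcarry n
  have hcont_symm : Continuous (n • dilationAut h hg hcarry).symm := by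
    have := continuous_zsmul_dilationAut h hg hcarry (-n)
    rwa [neg_zsmul] at this
  have := (n • dilationAut h hg hcarry).isAddHaarMeasure_map μ hcont hcont_symm
  refine ⟨hcont.measurable, ?_⟩
  rw [Measure.isAddLeftInvariant_eq_smul (μ.map (n • dilationAut h hg hcarry)) μ]
  exact Measure.smul_absolutelyContinuous

end ChainMeasures

section DualMeasures

variable {G : Type*} [AddCommGroup G] [TopologicalSpace G] [IsTopologicalAddGroup G]
  [LocallyCompactSpace G] {p : ℕ} [hp : Fact p.Prime] {Gs : ℤ → AddSubgroup G} {g : ℤ → G}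
  {r : ℤ → Chars G} [MeasurableSpace (Chars G)] [BorelSpace (Chars G)]

theorem IsRademacher.measureReal_ann (hr : IsRademacher Gs r) (h : IsBasicChain p Gs)
    (hg : IsBasicSystem Gs g) {ν : Measure (Chars G)} [ν.IsMulLeftInvariant]
    (hν : ν (annihilator Gs 0) = 1) (n : ℤ) :
    ν.real (ann (Gs n) : Set (Chars G)) = (p : ℝ) ^ n := by
  refine eq_zpow_of_succ (f := fun n => ν.real (ann (Gs n) : Set (Chars G)))
    (Nat.cast_ne_zero.2 hp.out.ne_zero) (congrArg ENNReal.toReal hν) (fun n => ?_) n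
  have hmeas (k : ℤ) : MeasurableSet (ann (Gs k) : Set (Chars G)) :=
    (isOpen_ann (h.isCompact k)).measurableSet
  have := relIndex_mul_measureReal (hmeas n) (hmeas (n + 1)) (ann_anti (h.succ_le n))
    (hr.relIndex_ann h hg n ▸ hp.out.ne_zero) ν
  rw [← this, hr.relIndex_ann h hg]

theorem IsRademacher.measure_ann_ne_top (hr : IsRademacher Gs r) (h : IsBasicChain p Gs)
    (hg : IsBasicSystem Gs g) {ν : Measure (Chars G)} [ν.IsMulLeftInvariant]
    (hν : ν (annihilator Gs 0) = 1) (n : ℤ) : ν (ann (Gs n)) ≠ ⊤ := fun he => by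
  have hpos : (0 : ℝ) < (p : ℝ) ^ n := zpow_pos (Nat.cast_pos.2 hp.out.pos) n
  rw [← hr.measureReal_ann h hg hν, measureReal_def, he, ENNReal.toReal_top] at hpos
  exact hpos.false

end DualMeasures

section SquareIntegrable

variable {α E : Type*} [MeasurableSpace α] [NormedAddCommGroup E]

theorem sq_eLpNorm_two (m : Measure α) (f : α → E) :
    eLpNorm f 2 m ^ 2 = ∫⁻ x, ‖f x‖ₑ ^ 2 ∂m := by
  rw [eLpNorm_eq_lintegral_rpow_enorm_toReal two_ne_zero ENNReal.ofNat_ne_top,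
    ← ENNReal.rpow_natCast, ← ENNReal.rpow_mul]
  simp

theorem integral_norm_sq_eq {m : Measure α} {f : α → E} (hf : MemLp f 2 m) :
    ∫ x, ‖f x‖ ^ 2 ∂m = (eLpNorm f 2 m).toReal ^ 2 := by
  rw [← ENNReal.toReal_pow, sq_eLpNorm_two, integral_eq_lintegral_of_nonneg_ae
    (Eventually.of_forall fun x => sq_nonneg _) (hf.1.norm.pow 2)]
  simp only [ENNReal.ofReal_pow (norm_nonneg _), ofReal_norm]

theorem tendsto_integral_norm_sq {m : Measure α} {F : ℕ → α → E} {f : α → E}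
    (hF : ∀ k, MemLp (F k) 2 m) (hf : MemLp f 2 m)
    (h : Tendsto (fun k => eLpNorm (fun x => f x - F k x) 2 m) atTop (𝓝 0)) :
    Tendsto (fun k => ∫ x, ‖F k x‖ ^ 2 ∂m) atTop (𝓝 (∫ x, ‖f x‖ ^ 2 ∂m)) := by
  have hlim : Tendsto (fun k => (hF k).toLp) atTop (𝓝 hf.toLp) := by
    rw [Lp.tendsto_Lp_iff_tendsto_eLpNorm'']
    refine h.congr fun k => ?_
    rw [← Pi.sub_def, eLpNorm_sub_comm]
  have := hlim.norm.pow 2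
  simp only [Lp.norm_toLp] at this
  rw [integral_norm_sq_eq hf]
  simpa only [integral_norm_sq_eq (hF _)] using this

theorem hasSum_of_tendsto_sum {ι : Type*} {a : ι → ℝ} (ha : ∀ i, 0 ≤ a i) {S : ℕ → Finset ι}
    (hS : Monotone S) (hex : ∀ i, ∃ k, i ∈ S k) {c : ℝ}
    (hc : Tendsto (fun k => ∑ i ∈ S k, a i) atTop (𝓝 c)) : HasSum a c := by
  have hexhaust := tendsto_atTop_finset_of_monotone hS hex
  have hmono : Monotone fun k => ∑ i ∈ S k, a i := fun k l hkl =>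
    Finset.sum_le_sum_of_subset_of_nonneg (hS hkl) fun i _ _ => ha i
  have hsum : Summable a := by
    refine summable_of_sum_le ha (c := c) fun u => ?_
    obtain ⟨k, hk⟩ := (hexhaust.eventually (eventually_ge_atTop u)).exists
    exact (Finset.sum_le_sum_of_subset_of_nonneg hk fun i _ _ => ha i).trans
      (hmono.ge_of_tendsto hc k)
  have := hsum.hasSum
  rwa [tendsto_nhds_unique (this.comp hexhaust) hc] at this

end SquareIntegrable

section FourierIntegral

variable {G : Type*} [AddCommGroup G] [TopologicalSpace G] [MeasurableSpace G]

theorem enorm_fourierInt_sq_le {m : Measure G} {f : G → ℂ} (hf : AEStronglyMeasurable f m)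
    (χ : Chars G) : ‖fourierInt m f χ‖ₑ ^ 2 ≤ (∫⁻ x, ‖f x‖ₑ ^ 2 ∂m) * m Set.univ := by
  have hL1 : ‖fourierInt m f χ‖ₑ ≤ eLpNorm f 1 m := by
    rw [eLpNorm_one_eq_lintegral_enorm]
    refine (enorm_integral_le_lintegral_enorm _).trans_eq (lintegral_congr fun x => ?_)
    rw [← ofReal_norm, norm_mul, RCLike.norm_conj, norm_pair, mul_one, ofReal_norm]
  calc ‖fourierInt m f χ‖ₑ ^ 2 ≤ (eLpNorm f 2 m * m Set.univ ^ (1 / 2 : ℝ)) ^ 2 := by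
        have := eLpNorm_le_eLpNorm_mul_rpow_measure_univ one_le_two hf
        norm_num at this ⊢
        gcongr
        exact hL1.trans this
    _ = (∫⁻ x, ‖f x‖ₑ ^ 2 ∂m) * m Set.univ := by
        rw [mul_pow, sq_eLpNorm_two, ← ENNReal.rpow_natCast (_ ^ (_ : ℝ)), ← ENNReal.rpow_mul]
        norm_num

theorem fourierInt_restrict_indicator {m : Measure G} {s t : Set G} (ht : MeasurableSet t)
    (hts : t ⊆ s) (f : G → ℂ) :
    fourierInt (m.restrict s) (t.indicator f) = fourierInt (m.restrict t) f := by
  ext χ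
  rw [fourierInt, fourierInt, ← Set.inter_eq_right.2 hts, ← setIntegral_indicator ht,
    Set.inter_eq_right.2 hts]
  simp only [Set.indicator_mul_left]

variable [BorelSpace G]

theorem integrable_mul_conj_pair {m : Measure G} {f : G → ℂ} (hf : Integrable f m)
    (χ : Chars G) : Integrable (fun x => f x * conj (pair χ x)) m := by
  refine hf.mul_bdd (c := 1) ?_ (Eventually.of_forall fun x => ?_)
  · exact (Complex.continuous_conj.comp (continuous_pair χ)).aestronglyMeasurable
  · rw [RCLike.norm_conj, norm_pair]

theorem fourierInt_sub {m : Measure G} {f f' : G → ℂ} (hf : Integrable f m)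
    (hf' : Integrable f' m) : fourierInt m (f - f') = fourierInt m f - fourierInt m f' := by
  ext χ
  simp only [fourierInt, Pi.sub_apply, sub_mul]
  exact integral_sub (integrable_mul_conj_pair hf χ) (integrable_mul_conj_pair hf' χ)

theorem fourierInt_mul_of_mem_ann [IsTopologicalAddGroup G] {H : AddSubgroup G}
    (hH : IsOpen (H : Set G)) {Q : Finset (G ⧸ H)} {S : Set G}
    (hS : QuotientAddGroup.mk ⁻¹' (Q : Set (G ⧸ H)) = S) {μ : Measure G} {f : G → ℂ}
    (hf : IntegrableOn f S μ) (ρ : Chars G)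
    {η : Chars G} (hη : η ∈ ann H) :
    fourierInt (μ.restrict S) f (ρ * η) =
      ∑ q ∈ Q, fourierInt (μ.restrict (coset q)) f ρ * conj (pair η q.out) := by
  have hmeas (q : G ⧸ H) : MeasurableSet (coset q) := (isOpen_preimage_mk hH _).measurableSet
  have hunion : S = ⋃ q ∈ Q, coset q :=
    hS ▸ (Set.biUnion_preimage_singleton _ _).symm
  rw [fourierInt, hunion, integral_biUnion_finset _ (fun q _ => hmeas q)
    (Set.pairwiseDisjoint_fiber _ _) fun q hq => ?_]
  · refine Finset.sum_congr rfl fun q _ => ?_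
    rw [fourierInt, ← integral_mul_const]
    refine setIntegral_congr_fun (hmeas q) fun x hx => ?_
    simp only [pair_mul, map_mul, pair_eq_pair_out hx hη, mul_assoc]
  · exact integrable_mul_conj_pair (hf.mono_set (hunion ▸
      Set.subset_biUnion_of_mem (u := fun q => coset q) hq)) _

end FourierIntegral

section Parseval

open scoped Pointwise

variable {G : Type*} [AddCommGroup G] [TopologicalSpace G] {H : AddSubgroup G}
  [MeasurableSpace (Chars G)] [BorelSpace (Chars G)] {ν : Measure (Chars G)} [ν.IsMulLeftInvariant]

theorem setIntegral_pair_ann (hH : IsCompact (H : Set G))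
    (hsep : ∀ x ∉ H, ∃ η ∈ ann H, pair η x ≠ 1) (x : G) [Decidable (x ∈ H)] :
    ∫ η in (ann H : Set (Chars G)), pair η x ∂ν =
      if x ∈ H then (ν.real (ann H : Set (Chars G)) : ℂ) else 0 := by
  split_ifs with hx
  · rw [setIntegral_congr_fun (isOpen_ann hH).measurableSet (g := fun _ => 1) fun η hη => hη x hx,
      setIntegral_const, Complex.real_smul, mul_one]
  · obtain ⟨t, ht, htx⟩ := hsep x hx
    exact setIntegral_eq_zero_of_map_mul_left ν ht htx fun η => pair_mul t η x

omit [ν.IsMulLeftInvariant] in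
theorem integrableOn_pair_ann (hν : ν (ann H) ≠ ⊤) (x : G) :
    IntegrableOn (fun η => pair η x) (ann H) ν :=
  Measure.integrableOn_of_bounded hν (continuous_pair_left x).aestronglyMeasurable
    (Eventually.of_forall fun η => (norm_pair η x).le)

theorem setIntegral_norm_sq_sum_ann (hH : IsCompact (H : Set G))
    (hsep : ∀ x ∉ H, ∃ η ∈ ann H, pair η x ≠ 1) (hν : ν (ann H) ≠ ⊤) (Q : Finset (G ⧸ H))
    (c : G ⧸ H → ℂ) :
    ∫ η in (ann H : Set (Chars G)), ‖∑ q ∈ Q, c q * conj (pair η q.out)‖ ^ 2 ∂ν =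
      ν.real (ann H : Set (Chars G)) * ∑ q ∈ Q, ‖c q‖ ^ 2 := by
  classical
  have hexpand (η : Chars G) : ((‖∑ q ∈ Q, c q * conj (pair η q.out)‖ ^ 2 : ℝ) : ℂ) =
      ∑ q ∈ Q, ∑ q' ∈ Q, pair η (q'.out - q.out) * (c q * conj (c q')) := by
    rw [Complex.ofReal_pow, ← Complex.mul_conj', map_sum, Finset.sum_mul_sum]
    refine Finset.sum_congr rfl fun q _ => Finset.sum_congr rfl fun q' _ => ?_
    rw [map_mul, Complex.conj_conj, pair_sub]
    ring
  have hmem (q q' : G ⧸ H) : q'.out - q.out ∈ H ↔ q = q' := by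
    rw [← mem_coset_mk, QuotientAddGroup.out_eq', Set.mem_preimage, QuotientAddGroup.out_eq',
      Set.mem_singleton_iff, eq_comm]
  have hint (q q' : G ⧸ H) : IntegrableOn
      (fun η => pair η (q'.out - q.out) * (c q * conj (c q'))) (ann H) ν :=
    (integrableOn_pair_ann hν _).mul_const _
  rw [← Complex.ofReal_inj, ← integral_complex_ofReal]
  simp only [hexpand]
  rw [integral_finsetSum _ fun q _ => integrable_finsetSum _ fun q' _ => hint q q',
    Complex.ofReal_mul, Complex.ofReal_sum, Finset.mul_sum]
  refine Finset.sum_congr rfl fun q hq => ?_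
  rw [integral_finsetSum _ fun q' _ => hint q q']
  simp only [integral_mul_const, setIntegral_pair_ann hH hsep, hmem, ite_mul, zero_mul]
  rw [Finset.sum_ite_eq, if_pos hq, Complex.mul_conj', Complex.ofReal_pow]

variable [IsTopologicalAddGroup G] [MeasurableSpace G] [BorelSpace G] {Q : Finset (G ⧸ H)}
  {S : Set G} {μ : Measure G} {f : G → ℂ}

theorem setIntegral_norm_sq_fourierInt (hHo : IsOpen (H : Set G)) (hH : IsCompact (H : Set G))
    (hsep : ∀ x ∉ H, ∃ η ∈ ann H, pair η x ≠ 1) (hν : ν (ann H) ≠ ⊤)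
    (hS : QuotientAddGroup.mk ⁻¹' (Q : Set (G ⧸ H)) = S) (hf : IntegrableOn f S μ) (ρ : Chars G) :
    ∫ χ in ρ • (ann H : Set (Chars G)),
        ‖fourierInt (μ.restrict S) f χ‖ ^ 2 ∂ν =
      ν.real (ann H : Set (Chars G)) * ∑ q ∈ Q, ‖fourierInt (μ.restrict (coset q)) f ρ‖ ^ 2 := by
  rw [← setIntegral_norm_sq_sum_ann hH hsep hν]
  refine ((measurePreserving_mul_left ν ρ).setIntegral_image_emb (measurableEmbedding_mulLeft ρ)
    _ _).trans ?_
  refine setIntegral_congr_fun (isOpen_ann hH).measurableSet fun η hη => ?_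
  exact congrArg (‖·‖ ^ 2) (fourierInt_mul_of_mem_ann hHo hS hf ρ hη)

omit [ν.IsMulLeftInvariant] in
theorem integrableOn_norm_sq_fourierInt (hHo : IsOpen (H : Set G)) (hH : IsCompact (H : Set G))
    (hν : ν (ann H) ≠ ⊤) (hS : QuotientAddGroup.mk ⁻¹' (Q : Set (G ⧸ H)) = S)
    (hf : IntegrableOn f S μ) :
    IntegrableOn (fun χ => ‖fourierInt (μ.restrict S) f χ‖ ^ 2) (ann H) ν := by
  have hcont : Continuous fun η : Chars G =>
      ∑ q ∈ Q, fourierInt (μ.restrict (coset q)) f 1 * conj (pair η q.out) :=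
    continuous_finsetSum _ fun q _ =>
      continuous_const.mul (Complex.continuous_conj.comp (continuous_pair_left _))
  refine (Measure.integrableOn_of_bounded hν (hcont.norm.pow 2).aestronglyMeasurable
    (M := (∑ q ∈ Q, ‖fourierInt (μ.restrict (coset q)) f 1‖) ^ 2)
    (Eventually.of_forall fun η => ?_)).congr_fun (fun η hη => ?_) (isOpen_ann hH).measurableSet
  · rw [Real.norm_eq_abs, abs_of_nonneg (sq_nonneg _)]
    refine pow_le_pow_left₀ (norm_nonneg _) ((norm_sum_le _ _).trans_eq ?_) 2
    simp only [norm_mul, RCLike.norm_conj, norm_pair, mul_one]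
  · exact congrArg (‖·‖ ^ 2)
      ((fourierInt_mul_of_mem_ann hHo hS hf 1 hη).symm.trans (by rw [one_mul]))

theorem setLIntegral_enorm_sq_fourierInt_le [μ.IsAddLeftInvariant] (hHo : IsOpen (H : Set G))
    (hH : IsCompact (H : Set G)) (hsep : ∀ x ∉ H, ∃ η ∈ ann H, pair η x ≠ 1)
    (hν : ν (ann H) ≠ ⊤) (hμν : ν (ann H) * μ H ≤ 1)
    (hS : QuotientAddGroup.mk ⁻¹' (Q : Set (G ⧸ H)) = S) (hf : IntegrableOn f S μ) :
    ∫⁻ χ in (ann H : Set (Chars G)),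
        ‖fourierInt (μ.restrict S) f χ‖ₑ ^ 2 ∂ν ≤
      ∫⁻ x in S, ‖f x‖ₑ ^ 2 ∂μ := by
  have hunion : S = ⋃ q ∈ Q, coset q := hS ▸ (Set.biUnion_preimage_singleton _ _).symm
  set F := fourierInt (μ.restrict S) f
  calc ∫⁻ χ in (ann H : Set (Chars G)), ‖F χ‖ₑ ^ 2 ∂ν
      = ENNReal.ofReal (∫ χ in (ann H : Set (Chars G)), ‖F χ‖ ^ 2 ∂ν) := by
        rw [ofReal_integral_eq_lintegral_ofReal (integrableOn_norm_sq_fourierInt hHo hH hν hS hf)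
          (Eventually.of_forall fun χ => sq_nonneg _)]
        simp only [ENNReal.ofReal_pow (norm_nonneg _), ofReal_norm, F]
    _ = ∑ q ∈ Q, ν (ann H) * ‖fourierInt (μ.restrict (coset q)) f 1‖ₑ ^ 2 := by
        have := setIntegral_norm_sq_fourierInt (ν := ν) hHo hH hsep hν hS hf 1
        rw [one_smul] at this
        rw [this, ENNReal.ofReal_mul measureReal_nonneg, ofReal_measureReal hν,
          ENNReal.ofReal_sum_of_nonneg (fun q _ => sq_nonneg _), Finset.mul_sum]
        simp only [ENNReal.ofReal_pow (norm_nonneg _), ofReal_norm]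
    _ ≤ ∑ q ∈ Q, ∫⁻ x in coset q, ‖f x‖ₑ ^ 2 ∂μ := by
        refine Finset.sum_le_sum fun q hq => ?_
        have hint := hf.mono_set (hunion ▸ Set.subset_biUnion_of_mem (u := fun q => coset q) hq)
        have hle := enorm_fourierInt_sq_le hint.aestronglyMeasurable 1
        rw [Measure.restrict_apply_univ, measure_coset] at hle
        calc _ ≤ ν (ann H) * ((∫⁻ x in coset q, ‖f x‖ₑ ^ 2 ∂μ) * μ H) := by gcongr
          _ = ν (ann H) * μ H * ∫⁻ x in coset q, ‖f x‖ₑ ^ 2 ∂μ := by ring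
          _ ≤ ∫⁻ x in coset q, ‖f x‖ₑ ^ 2 ∂μ := mul_le_of_le_one_left zero_le hμν
    _ = ∫⁻ x in S, ‖f x‖ₑ ^ 2 ∂μ := by
        rw [hunion, lintegral_biUnion_finset (Set.pairwiseDisjoint_fiber _ _)
          fun q _ => (isOpen_preimage_mk hHo _).measurableSet]

end Parseval

section FourierTransform

open scoped Pointwise

variable {G : Type*} [AddCommGroup G] [TopologicalSpace G] [IsTopologicalAddGroup G] {p : ℕ}
  {Gs : ℤ → AddSubgroup G} [MeasurableSpace G] {μ : Measure G}

theorem tendsto_eLpNorm_compl_chain [BorelSpace G] (h : IsBasicChain p Gs) {f : G → ℂ}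
    (hf : MemLp f 2 μ) :
    Tendsto (fun l : ℕ => (eLpNorm f 2 (μ.restrict (Gs (-(l : ℤ)) : Set G)ᶜ)).toReal)
      atTop (𝓝 0) := by
  have hsq := tendsto_setIntegral_of_antitone (μ := μ) (f := fun x => ‖f x‖ ^ 2)
    (s := fun l : ℕ => (Gs (-(l : ℤ)) : Set G)ᶜ) (fun l => (h.measurableSet _).compl)
    (fun l k hlk => Set.compl_subset_compl.2 (h.antitone (by omega)))
    ⟨0, (hf.integrable_norm_pow (p := 2) two_ne_zero).integrableOn⟩
  rw [← Set.compl_iUnion, h.iUnion_neg, Set.compl_univ, setIntegral_empty] at hsq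
  have hsqrt := hsq.sqrt
  rw [Real.sqrt_zero] at hsqrt
  refine hsqrt.congr fun l => ?_
  rw [integral_norm_sq_eq (hf.restrict _), Real.sqrt_sq ENNReal.toReal_nonneg]

variable [LocallyCompactSpace G] [hp : Fact p.Prime]

theorem IsBasicChain.integrableOn [μ.IsAddHaarMeasure] (h : IsBasicChain p Gs) {f : G → ℂ}
    (hf : MemLp f 2 μ) (n : ℤ) : IntegrableOn f (Gs n) μ :=
  (hf.locallyIntegrable one_le_two).integrableOn_isCompact (h.isCompact n)

variable [BorelSpace G]

theorem continuous_fourierInt_chain (h : IsBasicChain p Gs) {k : ℕ} {f : G → ℂ}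
    (hf : IntegrableOn f (Gs (-(k : ℤ))) μ) :
    Continuous (fourierInt (μ.restrict (Gs (-(k : ℤ)))) f) := by
  refine continuous_iff_continuousAt.2 fun χ => ?_
  obtain ⟨j, hkj, hχ⟩ := h.exists_mem_ann χ (-(k : ℤ))
  obtain ⟨Q, -, -, hQ⟩ := h.exists_exhaustion j
  have hcont : Continuous fun η : Chars G =>
      ∑ q ∈ Q k, fourierInt (μ.restrict (coset q)) f 1 * conj (pair η q.out) :=
    continuous_finsetSum _ fun q _ =>
      continuous_const.mul (Complex.continuous_conj.comp (continuous_pair_left _))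
  refine hcont.continuousAt.congr ?_
  filter_upwards [(isOpen_ann (h.isCompact j)).mem_nhds hχ] with η hη
  rw [← fourierInt_mul_of_mem_ann (h.isOpen j) (hQ k hkj) hf 1 hη, one_mul]

variable [μ.IsAddHaarMeasure] [MeasurableSpace (Chars G)] [BorelSpace (Chars G)]
  {ν : Measure (Chars G)} [ν.IsHaarMeasure] {g : ℤ → G} {r : ℤ → Chars G}
  (h : IsBasicChain p Gs) (hg : IsBasicSystem Gs g) (hr : IsRademacher Gs r)
  (hν : ν (annihilator Gs 0) = 1) (hμ : μ (Gs 0 : Set G) = 1)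

include h hg hr hμ hν

theorem eLpNorm_fourierInt_chain_le {f : G → ℂ} (hf : MemLp f 2 μ) (k : ℕ) :
    eLpNorm (fourierInt (μ.restrict (Gs (-(k : ℤ)))) f) 2 ν ≤
      eLpNorm f 2 (μ.restrict (Gs (-(k : ℤ)))) := by
  have hpiece (i : ℕ) : ∫⁻ χ in (ann (Gs (-(k : ℤ) + i)) : Set (Chars G)),
      ‖fourierInt (μ.restrict (Gs (-(k : ℤ)))) f χ‖ₑ ^ 2 ∂ν ≤
        ∫⁻ x in (Gs (-(k : ℤ)) : Set G), ‖f x‖ₑ ^ 2 ∂μ := by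
    obtain ⟨Q, -, -, hQ⟩ := h.exists_exhaustion (-(k : ℤ) + i)
    have hν_top := hr.measure_ann_ne_top h hg hν (-(k : ℤ) + i)
    refine setLIntegral_enorm_sq_fourierInt_le (h.isOpen _) (h.isCompact _)
      (fun x hx => hr.exists_pair_ne_one h hg hx) hν_top ?_ (hQ k (by omega)) (h.integrableOn hf _)
    rw [← ofReal_measureReal hν_top, hr.measureReal_ann h hg hν,
      ← ofReal_measureReal (h.isCompact _).measure_ne_top, h.measureReal hμ,
      ← ENNReal.ofReal_mul (by positivity), zpow_neg,
      mul_inv_cancel₀ (zpow_ne_zero _ (Nat.cast_ne_zero.2 hp.out.ne_zero)), ENNReal.ofReal_one]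
  have huniv : ⋃ i : ℕ, (ann (Gs (-(k : ℤ) + i)) : Set (Chars G)) = Set.univ := by
    refine Set.iUnion_eq_univ_iff.2 fun χ => ?_
    obtain ⟨j, hj, hχ⟩ := h.exists_mem_ann χ (-(k : ℤ))
    exact ⟨(j + k).toNat, ann_anti (h.antitone (by omega)) hχ⟩
  rw [← ENNReal.pow_le_pow_left_iff two_ne_zero, sq_eLpNorm_two, sq_eLpNorm_two,
    ← Measure.restrict_univ (μ := ν), ← huniv, setLIntegral_iUnion_of_directed]
  · exact iSup_le hpiece
  · exact Monotone.directed_le fun i i' hii => ann_anti (h.antitone (by omega))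

theorem memLp_fourierInt_chain {f : G → ℂ} (hf : MemLp f 2 μ) (k : ℕ) :
    MemLp (fourierInt (μ.restrict (Gs (-(k : ℤ)))) f) 2 ν :=
  ⟨(continuous_fourierInt_chain h (h.integrableOn hf _)).aestronglyMeasurable,
    (eLpNorm_fourierInt_chain_le h hg hr hν hμ hf k).trans_lt (hf.restrict _).2⟩

theorem eLpNorm_fourierInt_chain_sub_le {f : G → ℂ} (hf : MemLp f 2 μ) {k l : ℕ} (hlk : l ≤ k) :
    eLpNorm (fourierInt (μ.restrict (Gs (-(k : ℤ)))) f -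
        fourierInt (μ.restrict (Gs (-(l : ℤ)))) f) 2 ν ≤
      eLpNorm f 2 (μ.restrict (Gs (-(l : ℤ)) : Set G)ᶜ) := by
  have hm := h.measurableSet (-(l : ℤ))
  have hfl : MemLp ((Gs (-(l : ℤ)) : Set G).indicator f) 2 μ := hf.indicator hm
  rw [← fourierInt_restrict_indicator hm (h.antitone (by omega : -(k : ℤ) ≤ -(l : ℤ))) f,
    ← fourierInt_sub (h.integrableOn hf _) (h.integrableOn hfl _)]
  refine (eLpNorm_fourierInt_chain_le h hg hr hν hμ (hf.sub hfl) k).trans ?_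
  refine (eLpNorm_mono_measure _ Measure.restrict_le_self).trans_eq ?_
  rw [← eLpNorm_indicator_eq_eLpNorm_restrict hm.compl, Set.indicator_compl]

theorem isFourierL2_fourierL2 {f : G → ℂ} (hf : MemLp f 2 μ) :
    IsFourierL2 Gs μ ν f (fourierL2 Gs μ ν f) := by
  have hex : ∃ F, IsFourierL2 Gs μ ν f F := by
    have hmem := memLp_fourierInt_chain h hg hr hν hμ hf
    have hcauchy : CauchySeq fun k => (hmem k).toLp := by
      refine cauchySeq_of_le_tendsto_0'
        (fun l : ℕ => (eLpNorm f 2 (μ.restrict (Gs (-(l : ℤ)) : Set G)ᶜ)).toReal)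
        (fun l k hlk => ?_) (tendsto_eLpNorm_compl_chain h hf)
      rw [dist_comm, dist_edist, Lp.edist_toLp_toLp]
      exact ENNReal.toReal_mono (hf.restrict _).2.ne
        (eLpNorm_fourierInt_chain_sub_le h hg hr hν hμ hf hlk)
    obtain ⟨F, hF⟩ := cauchySeq_tendsto_of_complete hcauchy
    refine ⟨F, Lp.memLp F, ?_⟩
    rw [← Lp.toLp_coeFn F (Lp.memLp F), Lp.tendsto_Lp_iff_tendsto_eLpNorm''] at hF
    refine hF.congr fun k => ?_
    rw [eLpNorm_sub_comm]
    rfl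
  rw [fourierL2, dif_pos hex]
  exact hex.choose_spec

theorem hasSum_norm_sq_fourierInt_coset {f : G → ℂ} (hf : MemLp f 2 μ) {F : Chars G → ℂ}
    (hF : IsFourierL2 Gs μ ν f F) (ρ : Chars G) (j : ℤ) :
    HasSum (fun q : G ⧸ Gs j => (p : ℝ) ^ j * ‖fourierInt (μ.restrict (coset q)) f ρ‖ ^ 2)
      (∫ χ in ρ • (ann (Gs j) : Set (Chars G)), ‖F χ‖ ^ 2 ∂ν) := by
  obtain ⟨Q, hmono, hex, hQ⟩ := h.exists_exhaustion j
  refine hasSum_of_tendsto_sum (fun q => by positivity) hmono hex ?_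
  have hlim := tendsto_integral_norm_sq
    (m := ν.restrict (ρ • (ann (Gs j) : Set (Chars G))))
    (fun k => (memLp_fourierInt_chain h hg hr hν hμ hf k).restrict _) (hF.1.restrict _)
    (tendsto_of_tendsto_of_tendsto_of_le_of_le tendsto_const_nhds hF.2 (fun _ => zero_le)
      fun k => eLpNorm_mono_measure _ Measure.restrict_le_self)
  refine hlim.congr' ?_
  filter_upwards [eventually_ge_atTop (-j).toNat] with k hk
  rw [setIntegral_norm_sq_fourierInt (h.isOpen j) (h.isCompact j)
    (fun x hx => hr.exists_pair_ne_one h hg hx) (hr.measure_ann_ne_top h hg hν j)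
    (hQ k (by omega)) (h.integrableOn hf _), hr.measureReal_ann h hg hν, Finset.mul_sum]

theorem ae_eq_zero_of_isFourierL2_zero {f : G → ℂ} (hf : MemLp f 2 μ)
    (hF : IsFourierL2 Gs μ ν f 0) : f =ᵐ[μ] 0 := by
  refine h.ae_eq_zero_of_setIntegral_coset (h.integrableOn hf) fun j q => ?_
  have hpj : (p : ℝ) ^ j ≠ 0 := zpow_ne_zero _ (Nat.cast_ne_zero.2 hp.out.ne_zero)
  have hsum := hasSum_norm_sq_fourierInt_coset h hg hr hν hμ hf hF 1 j
  simp only [Pi.zero_apply, norm_zero, ne_eq, OfNat.ofNat_ne_zero, not_false_eq_true, zero_pow,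
    integral_zero] at hsum
  have hq := congrFun ((hasSum_zero_iff_of_nonneg fun q => by positivity).1 hsum) q
  simpa [fourierInt, pair_one, hpj] using hq

end FourierTransform

section QuotientSums

theorem hasSum_quotient_of_le {G : Type*} [AddGroup G] {K H : AddSubgroup G} (hle : K ≤ H) {N : ℕ}
    (hN : K.relIndex H = N) (hN0 : N ≠ 0) {a : G ⧸ H → ℝ} (ha : ∀ q, 0 ≤ a q) {c : ℝ}
    (hc : HasSum a c) :
    HasSum (fun q : G ⧸ K => a (AddSubgroup.quotientMapOfLE hle q)) (N * c) := by
  have hcard : Nat.card (H ⧸ K.addSubgroupOf H) = N := hN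
  have : Finite (H ⧸ K.addSubgroupOf H) := Nat.finite_of_card_ne_zero (hcard ▸ hN0)
  have := Fintype.ofFinite (H ⧸ K.addSubgroupOf H)
  have hone : HasSum (fun _ : H ⧸ K.addSubgroupOf H => (1 : ℝ)) N := by
    convert hasSum_fintype (fun _ : H ⧸ K.addSubgroupOf H => (1 : ℝ))
    rw [Finset.sum_const, nsmul_one, Finset.card_univ, ← Nat.card_eq_fintype_card, hcard]
  have hprod := hc.mul hone (hc.summable.mul_of_nonneg hone.summable ha fun _ => zero_le_one)
  rw [← (AddSubgroup.quotientEquivProdOfLE hle).hasSum_iff, mul_comm] at hprod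
  simp only [mul_one] at hprod
  exact hprod

end QuotientSums

section Wavelet

open scoped Pointwise

variable {G : Type*} [AddCommGroup G] [TopologicalSpace G]

/-- The function `p^l 1_{G_l} ρ`, whose Fourier transform is the indicator function of the coset
`ρ G_l^⊥`. -/
def cosetWavelet (p : ℕ) (Gs : ℤ → AddSubgroup G) (ρ : Chars G) (l : ℤ) : G → ℂ :=
  (Gs l : Set G).indicator fun x => (p : ℂ) ^ l * pair ρ x

variable [IsTopologicalAddGroup G] {p : ℕ} [hp : Fact p.Prime] {Gs : ℤ → AddSubgroup G}

section FourierTransform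

variable [MeasurableSpace G] [BorelSpace G] {μ : Measure G}

theorem fourierInt_cosetWavelet [μ.IsAddLeftInvariant] (h : IsBasicChain p Gs)
    (hμ : μ (Gs 0 : Set G) = 1) (ρ : Chars G) {k l : ℤ} (hkl : k ≤ l) :
    fourierInt (μ.restrict (Gs k)) (cosetWavelet p Gs ρ l) =
      (ρ • (ann (Gs l) : Set (Chars G))).indicator 1 := by
  ext χ
  rw [cosetWavelet, fourierInt_restrict_indicator (h.measurableSet l) (h.antitone hkl), fourierInt]
  have hpair (x : G) : pair ρ x * conj (pair χ x) = pair (ρ⁻¹ * χ)⁻¹ x := by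
    rw [pair_inv, pair_mul, pair_inv, map_mul, Complex.conj_conj]
  simp only [mul_assoc, hpair]
  by_cases hχ : χ ∈ ρ • (ann (Gs l) : Set (Chars G))
  · have hη : (ρ⁻¹ * χ)⁻¹ ∈ ann (Gs l) := inv_mem (Set.mem_smul_set_iff_inv_smul_mem.1 hχ)
    rw [Set.indicator_of_mem hχ, setIntegral_congr_fun (h.measurableSet l)
      (g := fun _ => (p : ℂ) ^ l) fun x hx => by simp only [hη x hx, mul_one],
      setIntegral_const, h.measureReal hμ, Complex.real_smul, Complex.ofReal_zpow,
      Complex.ofReal_natCast, ← zpow_add₀ (Nat.cast_ne_zero.2 hp.out.ne_zero), neg_add_cancel,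
      zpow_zero, Pi.one_apply]
  · have hη : (ρ⁻¹ * χ)⁻¹ ∉ ann (Gs l) := fun hη =>
      hχ (Set.mem_smul_set_iff_inv_smul_mem.2 (inv_mem_iff.1 hη))
    obtain ⟨t, ht, htη⟩ : ∃ t ∈ Gs l, pair (ρ⁻¹ * χ)⁻¹ t ≠ 1 := by
      simpa only [mem_ann, not_forall, exists_prop] using hη
    rw [Set.indicator_of_notMem hχ]
    exact setIntegral_eq_zero_of_map_add_left μ ht htη fun x => by rw [pair_add, mul_left_comm]

variable [LocallyCompactSpace G] [μ.IsAddHaarMeasure]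

theorem memLp_cosetWavelet (h : IsBasicChain p Gs) (ρ : Chars G) (l : ℤ) :
    MemLp (cosetWavelet p Gs ρ l) 2 μ := by
  rw [cosetWavelet, memLp_indicator_iff_restrict (h.measurableSet l)]
  have : IsFiniteMeasure (μ.restrict (Gs l : Set G)) :=
    isFiniteMeasure_restrict.2 (h.isCompact l).measure_ne_top
  refine MemLp.of_bound (continuous_const.mul (continuous_pair ρ)).aestronglyMeasurable
    ‖(p : ℂ) ^ l‖ (Eventually.of_forall fun x => ?_)
  rw [norm_mul, norm_pair, mul_one]

variable [MeasurableSpace (Chars G)] [BorelSpace (Chars G)] {ν : Measure (Chars G)}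
  [ν.IsHaarMeasure] {g : ℤ → G} {r : ℤ → Chars G}

theorem ae_eq_cosetWavelet (h : IsBasicChain p Gs) (hg : IsBasicSystem Gs g)
    (hr : IsRademacher Gs r) (hν : ν (annihilator Gs 0) = 1) (hμ : μ (Gs 0 : Set G) = 1)
    {ρ : Chars G} {l : ℤ} {ψ : G → ℂ} (hψ : MemLp ψ 2 μ)
    (hψρ : fourierL2 Gs μ ν ψ =ᵐ[ν] (ρ • (ann (Gs l) : Set (Chars G))).indicator 1) :
    ψ =ᵐ[μ] cosetWavelet p Gs ρ l := by
  have hw : MemLp (cosetWavelet p Gs ρ l) 2 μ := memLp_cosetWavelet h ρ l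
  have hF : IsFourierL2 Gs μ ν (ψ - cosetWavelet p Gs ρ l) 0 := by
    refine ⟨MemLp.zero, (isFourierL2_fourierL2 h hg hr hν hμ hψ).2.congr' ?_⟩
    filter_upwards [eventually_ge_atTop (-l).toNat] with k hk
    refine eLpNorm_congr_ae ?_
    filter_upwards [hψρ] with χ hχ
    rw [fourierInt_sub (h.integrableOn hψ _) (h.integrableOn hw _),
      fourierInt_cosetWavelet h hμ ρ (by omega), hχ, Pi.sub_apply, Pi.zero_apply]
    ring
  filter_upwards [ae_eq_zero_of_isFourierL2_zero h hg hr hν hμ (hψ.sub hw) hF] with x hx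
  exact sub_eq_zero.1 hx

end FourierTransform

variable [LocallyCompactSpace G] {g : ℤ → G} (h : IsBasicChain p Gs)
  (hg : IsBasicSystem Gs g) (hcarry : HasUniformCarry p g)

theorem bijective_symm_H0 (n : ℤ) : Function.Bijective fun x : H0 p g =>
    (((n • dilationAut h hg hcarry).symm x : G) : G ⧸ Gs n) := by
  obtain ⟨hinj, hsurj⟩ := hg.bijective_H0 h
  set B := n • dilationAut h hg hcarry
  have hiff (x y : G) : ((B.symm x : G) : G ⧸ Gs n) = (y : G ⧸ Gs n) ↔
      (x : G ⧸ Gs 0) = ((B y : G) : G ⧸ Gs 0) := by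
    rw [QuotientAddGroup.eq_iff_sub_mem, QuotientAddGroup.eq_iff_sub_mem,
      mem_iff_zsmul_dilationAut_mem h hg hcarry (n := n), sub_self, map_sub, B.apply_symm_apply]
  refine ⟨fun x y hxy => hinj ?_, fun q => ?_⟩
  · have := (hiff _ _).1 hxy
    rwa [B.apply_symm_apply] at this
  · obtain ⟨y, rfl⟩ := QuotientAddGroup.mk_surjective q
    obtain ⟨x, hx⟩ := hsurj (B y : G)
    exact ⟨x, (hiff _ _).2 hx⟩

theorem cosetWavelet_zsmul_dilationAut_sub (ρ : Chars G) (l n : ℤ) (x y : G) :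
    cosetWavelet p Gs ρ l ((n • dilationAut h hg hcarry) x - y) =
      (coset (((n • dilationAut h hg hcarry).symm y : G) : G ⧸ Gs (n + l))).indicator
        (fun x => (p : ℂ) ^ l * conj (pair ρ y) * pair (charDil p g n ρ) x) x := by
  set B := n • dilationAut h hg hcarry
  have hiff : B x - y ∈ (Gs l : Set G) ↔ x ∈ coset ((B.symm y : G) : G ⧸ Gs (n + l)) := by
    rw [mem_coset_mk, mem_iff_zsmul_dilationAut_mem h hg hcarry (n := n), add_sub_cancel_left,
      map_sub, B.apply_symm_apply, SetLike.mem_coe]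
  by_cases hx : B x - y ∈ (Gs l : Set G)
  · rw [cosetWavelet, Set.indicator_of_mem hx, Set.indicator_of_mem (hiff.1 hx),
      pair_charDil h hg hcarry, pair_sub]
    ring
  · rw [cosetWavelet, Set.indicator_of_notMem hx, Set.indicator_of_notMem (hiff.not.1 hx)]

variable [MeasurableSpace G] [BorelSpace G] {μ : Measure G}

theorem waveletCoeff_cosetWavelet (ρ : Chars G) (l n : ℤ) (y : G) (f : G → ℂ) :
    waveletCoeff p g μ (cosetWavelet p Gs ρ l) n y f =
      (((p : ℝ) ^ ((n : ℝ) / 2) : ℝ) : ℂ) * ((p : ℂ) ^ l * pair ρ y) *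
        fourierInt (μ.restrict
          (coset (((n • dilationAut h hg hcarry).symm y : G) : G ⧸ Gs (n + l)))) f
          (charDil p g n ρ) := by
  rw [waveletCoeff, fourierInt, ← integral_const_mul,
    ← integral_indicator (isOpen_preimage_mk (h.isOpen _) _).measurableSet]
  congr with x
  rw [waveletShift, dilationPow_eq_zsmul h hg hcarry, cosetWavelet_zsmul_dilationAut_sub]
  by_cases hx : x ∈ coset (((n • dilationAut h hg hcarry).symm y : G) : G ⧸ Gs (n + l))
  · simp only [Set.indicator_of_mem hx, map_mul, map_zpow₀, map_natCast, Complex.conj_ofReal,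
      Complex.conj_conj]
    ring
  · simp only [Set.indicator_of_notMem hx, mul_zero, map_zero]

theorem norm_sq_waveletCoeff_cosetWavelet (ρ : Chars G) (l n : ℤ) (y : G) (f : G → ℂ) :
    ‖waveletCoeff p g μ (cosetWavelet p Gs ρ l) n y f‖ ^ 2 =
      (p : ℝ) ^ l * ((p : ℝ) ^ (n + l) * ‖fourierInt (μ.restrict
        (coset (((n • dilationAut h hg hcarry).symm y : G) : G ⧸ Gs (n + l)))) f
        (charDil p g n ρ)‖ ^ 2) := by
  have hhalf : ((p : ℝ) ^ ((n : ℝ) / 2)) ^ 2 = (p : ℝ) ^ n := by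
    rw [← Real.rpow_mul_natCast p.cast_nonneg, Nat.cast_ofNat, div_mul_cancel₀ _ two_ne_zero,
      Real.rpow_intCast]
  rw [waveletCoeff_cosetWavelet h hg hcarry, norm_mul, norm_mul, norm_mul, norm_pair, mul_one,
    norm_zpow, Complex.norm_natCast, mul_pow, mul_pow, Complex.norm_real, Real.norm_eq_abs,
    sq_abs, hhalf, zpow_add₀ (Nat.cast_ne_zero.2 hp.out.ne_zero)]
  ring

variable [μ.IsAddHaarMeasure]

include h hg hcarry in
theorem waveletCoeff_congr_ae {ψ ψ' : G → ℂ} (hψ : ψ =ᵐ[μ] ψ') (n : ℤ) (y : G) (f : G → ℂ) :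
    waveletCoeff p g μ ψ n y f = waveletCoeff p g μ ψ' n y f := by
  have hquasi := (measurePreserving_sub_right μ y).quasiMeasurePreserving.comp
    (quasiMeasurePreserving_zsmul_dilationAut h hg hcarry μ n)
  refine integral_congr_ae ?_
  filter_upwards [hquasi.ae hψ] with x hx
  simp only [Function.comp_apply] at hx
  rw [waveletShift, waveletShift, dilationPow_eq_zsmul h hg hcarry, hx]

variable [MeasurableSpace (Chars G)] [BorelSpace (Chars G)] {ν : Measure (Chars G)}
  [ν.IsHaarMeasure] {r : ℤ → Chars G}

include h hg hcarry in
theorem hasSum_norm_sq_waveletCoeff (hr : IsRademacher Gs r) (hν : ν (annihilator Gs 0) = 1)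
    (hμ : μ (Gs 0 : Set G) = 1) {ρ : Chars G} {s : ℕ} {ψ : G → ℂ}
    (hψ : ψ =ᵐ[μ] cosetWavelet p Gs ρ (-(s : ℤ))) {f : G → ℂ} (hf : MemLp f 2 μ) (n : ℤ) :
    HasSum (fun y : H0 p g => ‖waveletCoeff p g μ ψ n y f‖ ^ 2)
      (∫ χ in charDil p g n ρ • (ann (Gs (n + -(s : ℤ))) : Set (Chars G)),
        ‖fourierL2 Gs μ ν f χ‖ ^ 2 ∂ν) := by
  have hp0 : (p : ℝ) ≠ 0 := Nat.cast_ne_zero.2 hp.out.ne_zero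
  have hcosets := hasSum_norm_sq_fourierInt_coset h hg hr hν hμ hf
    (isFourierL2_fourierL2 h hg hr hν hμ hf) (charDil p g n ρ) (n + -(s : ℤ))
  have hindex : (Gs n).relIndex (Gs (n + -(s : ℤ))) = p ^ s := by
    simpa using h.relIndex_add (n + -(s : ℤ)) s
  have hfine := hasSum_quotient_of_le (h.antitone (by omega)) hindex
    (pow_ne_zero _ hp.out.ne_zero) (fun q => by positivity) hcosets
  rw [← (Equiv.ofBijective _ (bijective_symm_H0 h hg hcarry n)).hasSum_iff] at hfine
  have hscaled := hfine.mul_left ((p : ℝ) ^ (-(s : ℤ)))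
  rw [Nat.cast_pow, ← zpow_natCast, ← mul_assoc, ← zpow_add₀ hp0, neg_add_cancel, zpow_zero,
    one_mul] at hscaled
  refine hscaled.congr_fun fun y => ?_
  rw [waveletCoeff_congr_ae h hg hcarry hψ, norm_sq_waveletCoeff_cosetWavelet h hg hcarry]
  rfl

end Wavelet

section Mask

theorem mul_eq_indicator_one {X K : Type*} [MulZeroOneClass K] {F m : X → K} {E : Set X}
    (hone : ∀ χ ∈ E, F χ * m χ = 1) (hzero : ∀ χ ∉ E, m χ = 0) :
    (fun χ => F χ * m χ) = E.indicator 1 := by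
  ext χ
  by_cases hχ : χ ∈ E
  · rw [hone χ hχ, Set.indicator_of_mem hχ, Pi.one_apply]
  · rw [hzero χ hχ, mul_zero, Set.indicator_of_notMem hχ]

end Mask

end ZeroDim

end

open ZeroDim in
theorem lemma3p1_general
    {G : Type*} [AddCommGroup G] [TopologicalSpace G] [IsTopologicalAddGroup G]
    [LocallyCompactSpace G] [MeasurableSpace G] [BorelSpace G]
    [MeasurableSpace (Chars G)] [BorelSpace (Chars G)]
    (p : ℕ) (hp : p.Prime)
    (Gs : ℤ → AddSubgroup G) (hGs : IsBasicChain p Gs)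
    (g : ℤ → G) (hg : IsBasicSystem Gs g) (hcarry : HasUniformCarry p g)
    (r : ℤ → Chars G) (hr : IsRademacher Gs r)
    (μ : Measure G) [μ.IsAddHaarMeasure] (hμ : μ (Gs 0 : Set G) = 1)
    (ν : Measure (Chars G)) [ν.IsHaarMeasure] (hν : ν (annihilator Gs 0) = 1)
    (s : ℕ) (u : ℤ) (γ : ℤ → Fin p) (ψ : G → ℂ) (hψ : MemLp ψ 2 μ)
    (hψE : fourierL2 Gs μ ν ψ =ᵐ[ν] (dualCoset Gs r γ (-(s : ℤ)) u).indicator 1)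
    (f : G → ℂ) (hf : MemLp f 2 μ) (n : ℤ) :
    HasSum (fun h : H0 p g => ‖waveletCoeff p g μ ψ n h f‖ ^ 2)
      (∫ χ in charDil p g n '' dualCoset Gs r γ (-(s : ℤ)) u, ‖fourierL2 Gs μ ν f χ‖ ^ 2 ∂ν) ∧
    ((∀ k, charDil p g 1 (r k) = r (k + 1)) →
      HasSum (fun h : H0 p g => ‖waveletCoeff p g μ ψ n h f‖ ^ 2)
        (∫ χ in dualCoset Gs r (fun k => γ (k - n)) (n - s) (n + u),
          ‖fourierL2 Gs μ ν f χ‖ ^ 2 ∂ν)) := by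
  have := Fact.mk hp
  rw [dualCoset_eq_smul] at hψE
  have hψ' := ae_eq_cosetWavelet hGs hg hr hν hμ hψ hψE
  have hsum := hasSum_norm_sq_waveletCoeff (ν := ν) hGs hg hcarry hr hν hμ hψ' hf n
  rw [← image_charDil_smul hGs hg hcarry, ← dualCoset_eq_smul] at hsum
  refine ⟨hsum, fun hshift => ?_⟩
  rwa [image_charDil_dualCoset hGs hg hcarry hshift, ← sub_eq_add_neg] at hsum

open ZeroDim in
theorem lemma3p1
    {G : Type*} [AddCommGroup G] [TopologicalSpace G] [IsTopologicalAddGroup G]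
    [LocallyCompactSpace G] [MeasurableSpace G] [BorelSpace G]
    [MeasurableSpace (Chars G)] [BorelSpace (Chars G)]
    (p : ℕ) (hp : p.Prime)
    (Gs : ℤ → AddSubgroup G) (hGs : IsBasicChain p Gs)
    (g : ℤ → G) (hg : IsBasicSystem Gs g) (hcarry : HasUniformCarry p g)
    (r : ℤ → Chars G) (hr : IsRademacher Gs r)
    (μ : Measure G) [μ.IsAddHaarMeasure] (hμ : μ (Gs 0 : Set G) = 1)
    (ν : Measure (Chars G)) [ν.IsHaarMeasure] (hν : ν (annihilator Gs 0) = 1)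
    (M N : ℕ) (φ : G → ℂ) (hφ : IsStepFunction Gs M N φ)
    (s : ℕ) (hs : s ≤ N) (u : ℤ) (γ : ℤ → Fin p) (m : Chars G → ℂ)
    (hm_one : ∀ χ ∈ dualCoset Gs r γ (-(s : ℤ)) u,
      fourierInt μ φ (charDil p g (-1) χ) * m χ = 1)
    (hm_zero : ∀ χ ∉ dualCoset Gs r γ (-(s : ℤ)) u, m χ = 0)
    (ψ : G → ℂ) (hψ : MemLp ψ 2 μ)
    (hψm : fourierL2 Gs μ ν ψ =ᵐ[ν] fun χ => fourierInt μ φ (charDil p g (-1) χ) * m χ)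
    (f : G → ℂ) (hf : MemLp f 2 μ) (n : ℤ) :
    HasSum (fun h : H0 p g => ‖waveletCoeff p g μ ψ n h f‖ ^ 2)
      (∫ χ in charDil p g n '' dualCoset Gs r γ (-(s : ℤ)) u, ‖fourierL2 Gs μ ν f χ‖ ^ 2 ∂ν) ∧
    ((∀ k, charDil p g 1 (r k) = r (k + 1)) →
      HasSum (fun h : H0 p g => ‖waveletCoeff p g μ ψ n h f‖ ^ 2)
        (∫ χ in dualCoset Gs r (fun k => γ (k - n)) (n - s) (n + u),
          ‖fourierL2 Gs μ ν f χ‖ ^ 2 ∂ν)) := by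
  rw [mul_eq_indicator_one hm_one hm_zero] at hψm
  exact lemma3p1_general p hp Gs hGs g hg hcarry r hr μ hμ ν hν s u γ ψ hψ hψm f hf n
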